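/- Let $A$ be an associative (not necessarily commutative) ring with $1$, equipped with an involution $a\mapsto\overline a$ (an additive map with $\overline{ab}=\overline b\,\overline a$ and $\overline{\overline a}=a$), let $\lambda$ be a central element of $A$ with $\lambda\overline\lambda=1$, and let $\Lambda$ be a form parameter, that is, an additive subgroup of $A$ with $\{c-\lambda\overline c\mid c\in A\}\subseteq\Lambda\subseteq\{c\in A\mid c=-\lambda\overline c\}$ and $c\Lambda\overline c\subseteq\Lambda$ for all $c\in A$. A form ideal $(I,\Gamma)$ of the form ring $(A,\Lambda)$ consists of a two-sided ideal $I$ with $\overline I=I$ and an additive subgroup $\Gamma$ with $$\{a-\lambda\overline a\mid a\in I\}+\langle ac\overline a\mid a\in I,\ c\in\Lambda\rangle\subseteq\Gamma\subseteq I\cap\Lambda$$ and $c\Gamma\overline c\subseteq\Gamma$ for all $c\in A$. Let $n\ge 3$. Index rows and columns of $2n\times 2n$ matrices by $1,\dots,n,-n,\dots,-1$ and let $\varepsilon(i)=\pm1$ be the sign of the index $i$. Put $T_{ij}(c)=e+ce_{ij}-\lambda^{(\varepsilon(j)-\varepsilon(i))/2}\,\overline c\,e_{-j,-i}$ for $i\ne\pm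 j$, $c\in A$, and $T_{i,-i}(c)=e+ce_{i,-i}$ for $c\in\lambda^{-(\varepsilon(i)+1)/2}\Lambda$. Let $\operatorname{FU}(2n,I,\Gamma)$ be the subgroup of $\operatorname{GL}(2n,A)$ generated by all $T_{ij}(a)$ with $i\ne\pm j$, $a\in I$, and all $T_{i,-i}(a)$ with $a\in\lambda^{-(\varepsilon(i)+1)/2}\Gamma$. Let $\operatorname{EU}(2n,A,\Lambda)$ be the subgroup generated by all $T_{ij}(c)$, $i\neq\pm j$, $c\in A$, and all $T_{i,-i}(c)$, $c\in\lambda^{-(\varepsilon(i)+1)/2}\Lambda$, and let $\operatorname{EU}(2n,I,\Gamma)$ be the normal closure of $\operatorname{FU}(2n,I,\Gamma)$ in $\operatorname{EU}(2n,A,\Lambda)$. Then for any two form ideals $(I,\Gamma)$ and $(J,\Delta)$ of $(A,\Lambda)$ the mixed commutator subgroup $[\operatorname{FU}(2n,I,\Gamma),\operatorname{FU}(2n,J,\Delta)]$ is a normal subgroup of $\operatorname{EU}(2n,A,\Lambda)$, and $$[\operatorname{FU}(2n,I,\Gamma),\operatorname{FU}(2n,J,\Delta)]=[\operatorname{EU}(2n,I,\Gamma),\operatorname{EU}(2n,J,\Delta)].$$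 -/

import Mathlib

/-!  Form rings, form ideals and elementary subgroups of Bak's hyperbolic unitary groups. -/

namespace BakUnitary

/-- The set `{c - lam * star c | c ∈ A}`, the smallest form parameter. -/
def lambdaMin {A : Type*} [Ring A] [StarRing A] (lam : A) : Set A :=
  {x | ∃ c : A, x = c - lam * star c}

/-- The set `{c ∈ A | c = - lam * star c}`, the largest form parameter. -/
def lambdaMax {A : Type*} [Ring A] [StarRing A] (lam : A) : Set A :=
  {c | c = -(lam * star c)}

/-- The form ring structures `(A, Λ)` on an associative ring `A` with `1` and with involution
`star`: a symmetry `lam`, that is, a central element with `lam * star lam = 1`, and a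
form parameter `Λ`. -/
structure FormRing (A : Type*) [Ring A] [StarRing A] where
  lam : A
  lam_central : lam ∈ Subring.center A
  lam_mul_star : lam * star lam = 1
  Lam : AddSubgroup A
  min_subset : lambdaMin lam ⊆ (Lam : Set A)
  subset_max : (Lam : Set A) ⊆ lambdaMax lam
  conj_mem : ∀ c x : A, x ∈ Lam → c * x * star c ∈ Lam

namespace FormRing

variable {A : Type*} [Ring A] [StarRing A]

/-- The symmetry as a unit of `A`, with inverse `star lam`. -/
def lamUnit (F : FormRing A) : Aˣ where
  val := F.lam
  inv := star F.lam
  val_inv := F.lam_mul_star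
  inv_val := (Subring.mem_center_iff.mp F.lam_central (star F.lam)).trans F.lam_mul_star

/-- `Γ_max(I) = I ∩ Λ`. -/
def gammaMax (F : FormRing A) (I : TwoSidedIdeal A) : Set A :=
  (I : Set A) ∩ (F.Lam : Set A)

/-- `Γ_min(I) = {a - lam * star a | a ∈ I} + ⟨a * c * star a | a ∈ I, c ∈ Λ⟩`. -/
def gammaMin (F : FormRing A) (I : TwoSidedIdeal A) : AddSubgroup A :=
  AddSubgroup.closure {x | ∃ a ∈ I, x = a - F.lam * star a} ⊔
    AddSubgroup.closure {x | ∃ a ∈ I, ∃ c ∈ F.Lam, x = a * c * star a}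

end FormRing

/-- A form ideal `(I, Γ)` of the form ring `F`: a two-sided ideal `I`, invariant under the
involution, and a relative form parameter `Γ` of level `I`. -/
structure FormIdeal {A : Type*} [Ring A] [StarRing A] (F : FormRing A) where
  I : TwoSidedIdeal A
  star_mem : ∀ a ∈ I, star a ∈ I
  Gam : AddSubgroup A
  min_subset : (F.gammaMin I : Set A) ⊆ (Gam : Set A)
  subset_max : (Gam : Set A) ⊆ F.gammaMax I
  conj_mem : ∀ c x : A, x ∈ Gam → c * x * star c ∈ Gam

/-- The index set `{1, …, n, -n, …, -1}`: `Sum.inl k` stands for the positive index `k + 1`,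
and `Sum.inr k` for the negative index `-(k + 1)`. -/
abbrev Idx (n : ℕ) : Type := Fin n ⊕ Fin n

/-- The index `-i`. -/
def Idx.opp {n : ℕ} (i : Idx n) : Idx n := Sum.swap i

/-- The sign of an index, `+1` or `-1`. -/
def Idx.sgn {n : ℕ} (i : Idx n) : ℤ := Sum.elim (fun _ => 1) (fun _ => -1) i

theorem Idx.opp_ne {n : ℕ} (i : Idx n) : i.opp ≠ i := by
  cases i <;> simp [Idx.opp]

theorem Idx.opp_opp {n : ℕ} (i : Idx n) : i.opp.opp = i := by
  cases i <;> simp [Idx.opp]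

/-- The general linear group `GL(2n, A)`. -/
abbrev GL2n (n : ℕ) (A : Type*) [Ring A] : Type _ := (Matrix (Idx n) (Idx n) A)ˣ

/-- For a square-zero element `N` of a ring, the unit `1 + N`, with inverse `1 - N`. -/
def unipotent {R : Type*} [Ring R] (N : R) (h : N * N = 0) : Rˣ where
  val := 1 + N
  inv := 1 - N
  val_inv := by simp [mul_sub, add_mul, h]
  inv_val := by simp [mul_add, sub_mul, h]

namespace FormRing

variable {A : Type*} [Ring A] [StarRing A]

/-- `c e_{ij} - lam^{(ε(j) - ε(i)) / 2} (star c) e_{-j,-i}`. -/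
def shortNil (F : FormRing A) {n : ℕ} (i j : Idx n) (c : A) : Matrix (Idx n) (Idx n) A :=
  Matrix.single i j c -
    Matrix.single j.opp i.opp (((F.lamUnit ^ ((j.sgn - i.sgn) / 2) : Aˣ) : A) * star c)

theorem shortNil_sq (F : FormRing A) {n : ℕ} {i j : Idx n} (h : i ≠ j) (c : A) :
    F.shortNil i j c * F.shortNil i j c = 0 := by
  have h1 : i.opp ≠ j.opp := fun e => h (by rw [← i.opp_opp, e, j.opp_opp])
  simp [shortNil, mul_sub, sub_mul, Matrix.single_mul_single_of_ne, h.symm, h1,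
    (Idx.opp_ne j).symm, Idx.opp_ne i]

/-- The elementary unitary transvection of short root type
`T_{ij}(c) = e + c e_{ij} - lam^{(ε(j) - ε(i)) / 2} (star c) e_{-j,-i}`
(used only for `i ≠ ± j`). -/
def shortT (F : FormRing A) {n : ℕ} (i j : Idx n) (h : i ≠ j) (c : A) : GL2n n A :=
  unipotent (F.shortNil i j c) (F.shortNil_sq h c)

end FormRing

/-- The elementary unitary transvection of long root type `T_{i,-i}(c) = e + c e_{i,-i}`. -/
def longT {A : Type*} [Ring A] {n : ℕ} (i : Idx n) (c : A) : GL2n n A :=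
  unipotent (Matrix.single i i.opp c) (by simp [Matrix.single_mul_single_of_ne, Idx.opp_ne i])

namespace FormRing

variable {A : Type*} [Ring A] [StarRing A]

/-- The subgroup of `GL(2n, A)` generated by all `T_{ij}(a)` with `i ≠ ± j`, `a ∈ S`, and all
`T_{i,-i}(a)` with `a ∈ lam^{-(ε(i) + 1) / 2} P`. -/
def elementarySubgroup (F : FormRing A) (n : ℕ) (S P : Set A) : Subgroup (GL2n n A) :=
  Subgroup.closure
    ({g | ∃ (i j : Idx n) (h : i ≠ j) (_ : i ≠ j.opp), ∃ a ∈ S, g = F.shortT i j h a} ∪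
     {g | ∃ i : Idx n, ∃ p ∈ P,
        g = longT i (((F.lamUnit ^ (-((i.sgn + 1) / 2)) : Aˣ) : A) * p)})

/-- The (absolute) elementary unitary group `EU(2n, A, Λ)`. -/
def EU (F : FormRing A) (n : ℕ) : Subgroup (GL2n n A) :=
  F.elementarySubgroup n Set.univ (F.Lam : Set A)

end FormRing

namespace FormIdeal

variable {A : Type*} [Ring A] [StarRing A] {F : FormRing A}

/-- The (unrelative) elementary subgroup `FU(2n, I, Γ)` of level `(I, Γ)`. -/
def FU (X : FormIdeal F) (n : ℕ) : Subgroup (GL2n n A) :=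
  F.elementarySubgroup n (X.I : Set A) (X.Gam : Set A)

theorem FU_le_EU (X : FormIdeal F) (n : ℕ) : X.FU n ≤ F.EU n := by
  refine Subgroup.closure_mono (Set.union_subset_union ?_ ?_)
  · rintro g ⟨i, j, h, h', a, -, rfl⟩
    exact ⟨i, j, h, h', a, Set.mem_univ a, rfl⟩
  · rintro g ⟨i, p, hp, rfl⟩
    exact ⟨i, p, (X.subset_max hp).2, rfl⟩

/-- The relative elementary subgroup `EU(2n, I, Γ)`: the normal closure of `FU(2n, I, Γ)` in the
group `EU(2n, A, Λ)`, regarded as a subgroup of `GL(2n, A)`. -/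
def relEU (X : FormIdeal F) (n : ℕ) : Subgroup (GL2n n A) :=
  (Subgroup.normalClosure (((X.FU n).subgroupOf (F.EU n) : Subgroup (F.EU n)) :
    Set (F.EU n))).map (F.EU n).subtype

end FormIdeal

end BakUnitary

/-!
Write `E = EU(2n, A, Λ)`, `P = FU(2n, I, Γ)`, `Q = FU(2n, J, Δ)` and `H = [P, Q]`. The groups `E`,
`P`, `Q` are generated by root subgroups, indexed by the roots `e_i - e_j` of a system of type `C_n`.
Three facts about these subgroups are used.

* Chevalley's commutator formula (`FormIdeal.commutatorFormula`): for `α ≠ -β`, the commutators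
  of elements of the root subgroups of `α` (level `(I, Γ)`) and `β` (level `(J, Δ)`) lie in
  the group generated by root subgroups of the roots `α + β`, `2α + β`, `α + 2β`, of level the
  symmetrized product `K` of the two form ideals (`FormIdeal.mul`), with ideal `IJ + JI`.
* Conversely, since `n ≥ 3`, the elements of the root subgroup of `α` of level `K` are products of
  commutators of elements of level `(I, Γ)` and `(J, Δ)` for roots other than `±α`
  (`FormIdeal.root_mul_le`).
* There is a set `T` of roots that contains no two opposite roots, although the root subgroups
  of `T` generate `E`; the same holds for `-T`, so that `T` can be chosen not to contain
  the opposite of a given root (`FormIdeal.exists_generating_roots`).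

The set `T` makes generators of normal closures accessible (`RootGroups.normalClosure_le`): the normal
closure in `E` of an elementary group `FU` is generated by `FU` and the conjugates `y x y⁻¹`, with
`x` in the root subgroup of `-α` for `FU` and `y` in that of `α` for `E`, `α ∈ T`.
Indeed, it is enough to conjugate these elements by the root subgroups of `γ ∈ T`; the
case `γ = -α`, in which the conjugate would leave the set of generators, does not occur, and for
`γ ≠ ±α` the root subgroup of `γ` is contained in a unipotent group normalized by those of `±α`.

Let `N` be the normal closure of the elementary group of level `K`. If `x = ∏ [u, w]` is an element
of level `K` as in the second fact, then conjugation by the opposite root subgroup keeps all `u` in `P`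
and all `w` in `Q`. Hence the generators of `N` belong to `H`, and `N ≤ H`. Modulo `N`, root elements of
`P` and `Q` commute unless the roots are opposite, and for opposite roots the commutator is
central in `E / N`: for `γ ≠ ±α` it commutes with the root subgroup of `γ` by the three subgroups lemma,
and the other two root subgroups are generated by commutators of these. So `[H, E] ≤ N ≤ H`, and
`H` is normal in `E` (`RootGroups.MixedSystem.commutator_normal`).

For the equality it is then enough to see that the generators `y x y⁻¹` of the normal closure of `P`
commute modulo `H` with the root elements `w` of `Q`. By normality of `H` this means that `x`
commutes with `y⁻¹ w y`, which belongs to `Q` unless the roots of `y` and `w` are opposite; this is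
avoided by the choice of `T` (`RootGroups.MixedSystem.commutator_normalClosure`).
-/

/-! ### Groups generated by root subgroups -/

namespace RootGroups

open scoped commutatorElement

section Commutators

variable {G : Type*} [Group G]

theorem commutator_closure_le {N : Subgroup G} [hN : N.Normal] {S T : Set G}
    (h : ∀ s ∈ S, ∀ t ∈ T, ⁅s, t⁆ ∈ N) :
    ⁅Subgroup.closure S, Subgroup.closure T⁆ ≤ N := by
  have key : ∀ {S T : Set G}, (∀ s ∈ S, ∀ t ∈ T, ⁅s, t⁆ ∈ N) →
      ∀ s ∈ Subgroup.closure S, ∀ t ∈ T, ⁅s, t⁆ ∈ N := by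
    intro S T h s hs t ht
    induction hs using Subgroup.closure_induction with
    | mem x hx => exact h x hx t ht
    | one => simp
    | mul x y _ _ hx hy =>
      have : ⁅x * y, t⁆ = x * ⁅y, t⁆ * x⁻¹ * ⁅x, t⁆ := by simp only [commutatorElement_def]; group
      rw [this]
      exact N.mul_mem (hN.conj_mem _ hy x) hx
    | inv x _ hx =>
      have : ⁅x⁻¹, t⁆ = x⁻¹ * ⁅x, t⁆⁻¹ * x⁻¹⁻¹ := by simp only [commutatorElement_def]; group
      rw [this]
      exact hN.conj_mem _ (N.inv_mem hx) _
  have swap : ∀ {s t : G}, ⁅s, t⁆ ∈ N → ⁅t, s⁆ ∈ N := fun {s t} h => by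
    rw [← commutatorElement_inv]; exact N.inv_mem h
  rw [Subgroup.commutator_le]
  intro s hs t ht
  exact swap (key (fun t ht s hs => swap (key h s hs t ht)) t ht s hs)

/-- The three subgroups lemma modulo a normal subgroup. -/
theorem commutator_commutator_le_of_rotate {N H₁ H₂ H₃ : Subgroup G} [N.Normal]
    (h1 : ⁅⁅H₂, H₃⁆, H₁⁆ ≤ N) (h2 : ⁅⁅H₃, H₁⁆, H₂⁆ ≤ N) : ⁅⁅H₁, H₂⁆, H₃⁆ ≤ N := by
  have key : ∀ {K : Subgroup G}, K ≤ N ↔ K.map (QuotientGroup.mk' N) = ⊥ := by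
    intro K
    rw [Subgroup.map_eq_bot_iff, QuotientGroup.ker_mk']
  rw [key, Subgroup.map_commutator, Subgroup.map_commutator] at h1 h2 ⊢
  exact Subgroup.commutator_commutator_eq_bot_of_rotate h1 h2

end Commutators

variable {G Φ V : Type*} [Group G] [AddCommGroup V]

/-- The subgroup generated by the members `P α`, `α ∈ D`, of a family of subgroups. -/
def span (P : Φ → Subgroup G) (D : Set Φ) : Subgroup G :=
  Subgroup.closure {x | ∃ α ∈ D, x ∈ P α}

theorem mem_span {P : Φ → Subgroup G} {D : Set Φ} {α : Φ} (hα : α ∈ D) {x : G} (hx : x ∈ P α) :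
    x ∈ span P D :=
  Subgroup.subset_closure ⟨α, hα, hx⟩

theorem span_le {P : Φ → Subgroup G} {D : Set Φ} {H : Subgroup G} :
    span P D ≤ H ↔ ∀ α ∈ D, P α ≤ H := by
  rw [span, Subgroup.closure_le]
  exact ⟨fun h α hα x hx => h ⟨α, hα, hx⟩, fun h x ⟨α, hα, hx⟩ => h α hα hx⟩

theorem span_mono {P : Φ → Subgroup G} {D D' : Set Φ} (h : D ⊆ D') : span P D ≤ span P D' :=
  span_le.2 fun _ hα _ hx => mem_span (h hα) hx

theorem span_mono_left {P Q : Φ → Subgroup G} (h : ∀ α, P α ≤ Q α) (D : Set Φ) :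
    span P D ≤ span Q D :=
  span_le.2 fun α hα _ hx => mem_span hα (h α hx)

/-- The indices whose root is a combination `pα + qβ` with `p, q > 0` that can occur in the
Chevalley commutator formula for a root system of type `C`. -/
def cone (rt : Φ → V) (α β : Φ) : Set Φ :=
  {δ | rt δ = rt α + rt β ∨ rt δ = 2 • rt α + rt β ∨ rt δ = rt α + 2 • rt β}

theorem cone_comm (rt : Φ → V) (α β : Φ) : cone rt α β = cone rt β α := by
  ext δ
  simp only [cone, Set.mem_ofPred_eq, add_comm (rt α), add_comm (2 • rt α)]
  tauto

/-- The Chevalley commutator formula: for roots `α ≠ -β`, the commutators of elements of `P α`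
and `Q β` are products of elements of the subgroups `S δ`, with `δ` in the cone of `α`, `β`. -/
def CommutatorFormula (rt : Φ → V) (P Q S : Φ → Subgroup G) : Prop :=
  ∀ α β, rt α + rt β ≠ 0 → ⁅P α, Q β⁆ ≤ span S (cone rt α β)

namespace CommutatorFormula

variable {rt : Φ → V} {P Q S : Φ → Subgroup G}

theorem symm (h : CommutatorFormula rt P Q S) : CommutatorFormula rt Q P S := by
  intro α β hαβ
  rw [Subgroup.commutator_comm, cone_comm]
  exact h β α (by rwa [add_comm])

theorem conj_mem (h : CommutatorFormula rt Q P P) {γ : Φ} {D : Set Φ}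
    (hγ : ∀ δ ∈ D, rt γ + rt δ ≠ 0) (hD : ∀ δ ∈ D, cone rt γ δ ⊆ D)
    {y u : G} (hy : y ∈ Q γ) (hu : u ∈ span P D) : y * u * y⁻¹ ∈ span P D := by
  have : span P D ≤ (span P D).comap (MulAut.conj y).toMonoidHom := by
    refine span_le.2 fun δ hδ x hx => ?_
    have e : y * x * y⁻¹ = ⁅y, x⁆ * x := by simp only [commutatorElement_def]; group
    have h1 : y * x * y⁻¹ ∈ span P D := by
      rw [e]
      exact mul_mem (span_mono (hD δ hδ) (h γ δ (hγ δ hδ) (Subgroup.commutator_mem_commutator hy hx)))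
        (mem_span hδ hx)
    simpa using h1
  simpa using this hu

theorem conj_mem_univ (h : CommutatorFormula rt Q P P) {γ δ : Φ} (hγ : rt γ + rt δ ≠ 0)
    {y u : G} (hy : y ∈ Q γ) (hu : u ∈ P δ) : y * u * y⁻¹ ∈ span P Set.univ := by
  have e : y * u * y⁻¹ = ⁅y, u⁆ * u := by simp only [commutatorElement_def]; group
  rw [e]
  exact mul_mem (span_mono (Set.subset_univ _)
    (h γ δ hγ (Subgroup.commutator_mem_commutator hy hu))) (mem_span (Set.mem_univ _) hu)

end CommutatorFormula

/-- Proportional roots are equal or opposite. -/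
def Reduced (rt : Φ → V) : Prop :=
  ∀ α β, ∀ p q : ℤ, 0 < p → p • rt α = q • rt β → rt α = rt β ∨ rt α = -rt β

/-- The conjugates `y x y⁻¹` with `x ∈ P α` and `y ∈ E β`, where `β` is the root opposite to `α`
and lies in `T`. -/
def oppositeConjugates (rt : Φ → V) (E P : Φ → Subgroup G) (T : Set Φ) : Set G :=
  {z | ∃ α, ∃ β ∈ T, rt α + rt β = 0 ∧ ∃ x ∈ P α, ∃ y ∈ E β, z = y * x * y⁻¹}

/-- The relative elementary subgroup is generated by the elements `x ∈ P α` and by their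
conjugates by the opposite root subgroups `E (-α)`, `-α ∈ T`, as soon as the set `T` contains no
two opposite roots and the root subgroups indexed by `T` generate the whole group.
The second condition makes it enough to conjugate by the `E γ`, `γ ∈ T`. The first one
excludes `γ = α`; for `γ ≠ ±α` one works in the unipotent group spanned by the roots
`pγ + qα`, `p > 0`, which is normalized by `E (±α)`. -/
theorem normalClosure_le {rt : Φ → V} (hred : Reduced rt) {E P : Φ → Subgroup G}
    (hE : ∀ α β, rt α = rt β → E α = E β) (hEE : CommutatorFormula rt E E E)
    (hEP : CommutatorFormula rt E P P) {T : Set Φ}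
    (hT : ∀ α ∈ T, ∀ β ∈ T, rt α + rt β ≠ 0) (hgen : span E T = ⊤) :
    Subgroup.normalClosure (span P Set.univ : Set G) ≤
      span P Set.univ ⊔ Subgroup.closure (oppositeConjugates rt E P T) := by
  set M := span P Set.univ ⊔ Subgroup.closure (oppositeConjugates rt E P T) with hM
  have hPM : span P Set.univ ≤ M := le_sup_left
  have hzM : ∀ z ∈ oppositeConjugates rt E P T, z ∈ M := fun z hz =>
    (le_sup_right : _ ≤ M) (Subgroup.subset_closure hz)
  have hx : ∀ γ ∈ T, ∀ y ∈ E γ, ∀ α, ∀ x ∈ P α, y * x * y⁻¹ ∈ M := by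
    intro γ hγ y hy α x hx
    by_cases h : rt γ + rt α = 0
    · exact hzM _ ⟨α, γ, hγ, by rwa [add_comm], x, hx, y, hy, rfl⟩
    · exact hPM (hEP.conj_mem_univ h hy hx)
  have hz : ∀ γ ∈ T, ∀ y ∈ E γ, ∀ z ∈ oppositeConjugates rt E P T, y * z * y⁻¹ ∈ M := by
    rintro γ hγ y hy _ ⟨α, β, hβ, hαβ, x, hx, y₀, hy₀, rfl⟩
    have hβα : rt β = -rt α := eq_neg_of_add_eq_zero_right hαβ
    by_cases h1 : rt γ = -rt α
    · refine hzM _ ⟨α, β, hβ, hαβ, x, hx, y * y₀, mul_mem ?_ hy₀, by group⟩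
      rwa [hE β γ (hβα.trans h1.symm)]
    have h2 : rt γ ≠ rt α := fun h2 => hT γ hγ β hβ (by rw [h2, hαβ])
    have hne : ∀ p q : ℤ, 0 < p → p • rt γ ≠ q • rt α := fun p q hp h =>
      (hred γ α p q hp h).elim h2 h1
    -- the half plane of the roots `pγ + qα`, `p > 0`
    let D : Set Φ := {δ | ∃ p q : ℤ, 0 < p ∧ rt δ = p • rt γ + q • rt α}
    have hDadd : ∀ δ ∈ D, ∀ m : ℤ, rt δ + m • rt α ≠ 0 := by
      rintro δ ⟨p, q, hp, h⟩ m h0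
      refine hne p (-(q + m)) hp ?_
      rw [h] at h0
      rw [neg_smul, eq_neg_iff_add_eq_zero, ← h0]; module
    have hDα : ∀ ε, (∃ m : ℤ, rt ε = m • rt α) → ∀ δ ∈ D, cone rt ε δ ⊆ D := by
      rintro ε ⟨m, hm⟩ δ ⟨p, q, hp, h⟩ ζ hζ
      rcases hζ with hζ | hζ | hζ
      · exact ⟨p, q + m, hp, by rw [hζ, h, hm]; module⟩
      · exact ⟨p, q + 2 * m, hp, by rw [hζ, h, hm]; module⟩
      · exact ⟨2 * p, 2 * q + m, by omega, by rw [hζ, h, hm]; module⟩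
    have hDD : ∀ ε ∈ D, ∀ δ ∈ D, cone rt ε δ ⊆ D := by
      rintro ε ⟨p', q', hp', h'⟩ δ ⟨p, q, hp, h⟩ ζ hζ
      rcases hζ with hζ | hζ | hζ
      · exact ⟨p + p', q + q', by omega, by rw [hζ, h, h']; module⟩
      · exact ⟨p + 2 * p', q + 2 * q', by omega, by rw [hζ, h, h']; module⟩
      · exact ⟨2 * p + p', 2 * q + q', by omega, by rw [hζ, h, h']; module⟩
    have hDD0 : ∀ ε ∈ D, ∀ δ ∈ D, rt ε + rt δ ≠ 0 := by
      rintro ε ⟨p', q', hp', h'⟩ δ ⟨p, q, hp, h⟩ h0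
      refine hne (p + p') (-(q + q')) (by omega) ?_
      rw [h, h'] at h0
      rw [neg_smul, eq_neg_iff_add_eq_zero, ← h0]; module
    have hβD : ∀ δ ∈ D, rt β + rt δ ≠ 0 := fun δ hδ h0 =>
      hDadd δ hδ (-1) (by rw [← h0, hβα]; module)
    have hβc := hDα β ⟨-1, by rw [hβα]; module⟩
    -- with `v = y₀⁻¹ y y₀`, the conjugate by `y` is `y₀ (v x v⁻¹) y₀⁻¹ = y₀ ([v, x] x) y₀⁻¹`
    have hv : y₀⁻¹ * y * y₀ ∈ span E D := by
      have := hEE.conj_mem hβD hβc (inv_mem hy₀)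
        (mem_span (P := E) (show γ ∈ D from ⟨1, 0, one_pos, by module⟩) hy)
      simpa using this
    have hcomm : ∀ v ∈ span E D, ⁅v, x⁆ ∈ span P D ∧
        ∀ u ∈ span P D, v * u * v⁻¹ ∈ span P D ∧ v⁻¹ * u * v ∈ span P D := by
      intro v hv
      induction hv using Subgroup.closure_induction with
      | mem v hv =>
        obtain ⟨δ, hδ, hvδ⟩ := hv
        refine ⟨?_, fun u hu => ⟨hEP.conj_mem (hDD0 δ hδ) (hDD δ hδ) hvδ hu, ?_⟩⟩
        · refine span_mono ?_ (hEP δ α (fun h0 => hDadd δ hδ 1 (by rw [← h0]; module))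
            (Subgroup.commutator_mem_commutator hvδ hx))
          rw [cone_comm]
          exact hDα α ⟨1, by module⟩ δ hδ
        · simpa using hEP.conj_mem (hDD0 δ hδ) (hDD δ hδ) (inv_mem hvδ) hu
      | one => exact ⟨by simp, fun u hu => by simpa using hu⟩
      | mul v w _ _ hv hw =>
        refine ⟨?_, fun u hu => ⟨?_, ?_⟩⟩
        · have e : ⁅v * w, x⁆ = v * ⁅w, x⁆ * v⁻¹ * ⁅v, x⁆ := by
            simp only [commutatorElement_def]; group
          rw [e]
          exact mul_mem (hv.2 _ hw.1).1 hv.1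
        · simpa [mul_assoc] using (hv.2 _ (hw.2 u hu).1).1
        · simpa [mul_assoc] using (hw.2 _ (hv.2 u hu).2).2
      | inv v _ hv =>
        refine ⟨?_, fun u hu => ⟨by simpa using (hv.2 u hu).2, by simpa using (hv.2 u hu).1⟩⟩
        have e : ⁅v⁻¹, x⁆ = v⁻¹ * ⁅v, x⁆⁻¹ * v := by simp only [commutatorElement_def]; group
        rw [e]
        exact (hv.2 _ (inv_mem hv.1)).2
    have e : y * (y₀ * x * y₀⁻¹) * y⁻¹ =
        (y₀ * ⁅y₀⁻¹ * y * y₀, x⁆ * y₀⁻¹) * (y₀ * x * y₀⁻¹) := by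
      simp only [commutatorElement_def]; group
    rw [e]
    exact mul_mem (hPM (span_mono (Set.subset_univ _)
      (hEP.conj_mem hβD hβc hy₀ (hcomm _ hv).1))) (hzM _ ⟨α, β, hβ, hαβ, x, hx, y₀, hy₀, rfl⟩)
  have hEM : ∀ γ ∈ T, ∀ y ∈ E γ, M ≤ M.comap (MulAut.conj y).toMonoidHom := by
    intro γ hγ y hy
    refine sup_le (span_le.2 fun α _ x hxα => ?_) ?_
    · simpa using hx γ hγ y hy α x hxα
    · rw [Subgroup.closure_le]
      intro z hzT
      simpa using hz γ hγ y hy z hzT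
  have htop : (⊤ : Subgroup G) ≤ Subgroup.normalizer (M : Set G) := by
    rw [← hgen]
    refine span_le.2 fun γ hγ y hy => ?_
    rw [Subgroup.mem_normalizer_iff]
    intro h
    refine ⟨fun hh => by simpa using hEM γ hγ y hy hh, fun hh => ?_⟩
    have := hEM γ hγ y⁻¹ (inv_mem hy) hh
    simpa [mul_assoc] using this
  have hMn : M.Normal := Subgroup.normalizer_eq_top_iff.1 (top_le_iff.1 htop)
  exact Subgroup.normalClosure_le_normal hPM

/-- The subgroup generated by the commutators of elements of `P β` and `Q γ`, for roots `β`, `γ`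
different from `±α`. -/
def commutatorsAvoiding (rt : Φ → V) (P Q : Φ → Subgroup G) (α : Φ) : Subgroup G :=
  Subgroup.closure {z | ∃ β γ, (rt β ≠ rt α ∧ rt β ≠ -rt α) ∧ (rt γ ≠ rt α ∧ rt γ ≠ -rt α) ∧
    ∃ u ∈ P β, ∃ w ∈ Q γ, z = ⁅u, w⁆}

/-- Root subgroups `E α` that generate the group, two families `P α`, `Q α` of relative root
subgroups, and a third family `K α` which plays the role of their symmetrized product. -/
structure MixedSystem (rt : Φ → V) (E P Q K : Φ → Subgroup G) : Prop where
  reduced : Reduced rt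
  congr : ∀ α β, rt α = rt β → E α = E β
  EE : CommutatorFormula rt E E E
  EP : CommutatorFormula rt E P P
  EQ : CommutatorFormula rt E Q Q
  EK : CommutatorFormula rt E K K
  PQ : CommutatorFormula rt P Q K
  le_E : ∀ α, E α ≤ commutatorsAvoiding rt E E α
  le_K : ∀ α, K α ≤ commutatorsAvoiding rt P Q α
  span_E : span E Set.univ = ⊤
  exists_gen : ∀ β, ∃ T : Set Φ, (∀ α ∈ T, ∀ γ ∈ T, rt α + rt γ ≠ 0) ∧
    (∀ α ∈ T, rt α + rt β ≠ 0) ∧ span E T = ⊤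

namespace MixedSystem

variable {rt : Φ → V} {E P Q K : Φ → Subgroup G}

/-- Conjugation by `E (-α)` keeps the elements of `P β` and `Q γ`, `β, γ ≠ ±α`, whose commutators
generate a group containing `K α`, inside the groups generated by the `P δ` and the `Q δ`. -/
theorem conj_mem_commutator (h : MixedSystem rt E P Q K) {α β : Φ} (hαβ : rt α + rt β = 0)
    {x y : G} (hx : x ∈ K α) (hy : y ∈ E β) :
    y * x * y⁻¹ ∈ ⁅span P Set.univ, span Q Set.univ⁆ := by
  have hβα : rt α = -rt β := eq_neg_of_add_eq_zero_left hαβ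
  have : commutatorsAvoiding rt P Q α ≤
      (⁅span P Set.univ, span Q Set.univ⁆).comap (MulAut.conj y).toMonoidHom := by
    rw [commutatorsAvoiding, Subgroup.closure_le]
    rintro _ ⟨γ, δ, ⟨hγ, -⟩, ⟨hδ, -⟩, u, hu, w, hw, rfl⟩
    have hγ' : rt β + rt γ ≠ 0 := fun h0 => hγ (by rw [hβα]; exact eq_neg_of_add_eq_zero_right h0)
    have hδ' : rt β + rt δ ≠ 0 := fun h0 => hδ (by rw [hβα]; exact eq_neg_of_add_eq_zero_right h0)
    have := Subgroup.commutator_mem_commutator (h.EP.conj_mem_univ hγ' hy hu)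
      (h.EQ.conj_mem_univ hδ' hy hw)
    simpa using this
  simpa using this (h.le_K α hx)

theorem normalClosure_le_commutator (h : MixedSystem rt E P Q K) (β : Φ) :
    Subgroup.normalClosure (span K Set.univ : Set G) ≤ ⁅span P Set.univ, span Q Set.univ⁆ := by
  obtain ⟨T, hT, -, hgen⟩ := h.exists_gen β
  refine (normalClosure_le h.reduced h.congr h.EE h.EK hT hgen).trans (sup_le ?_ ?_)
  · refine span_le.2 fun α _ x hx => ?_
    have : commutatorsAvoiding rt P Q α ≤ ⁅span P Set.univ, span Q Set.univ⁆ := by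
      rw [commutatorsAvoiding, Subgroup.closure_le]
      rintro _ ⟨γ, δ, -, -, u, hu, w, hw, rfl⟩
      exact Subgroup.commutator_mem_commutator (mem_span (Set.mem_univ _) hu)
        (mem_span (Set.mem_univ _) hw)
    exact this (h.le_K α hx)
  · rw [Subgroup.closure_le]
    rintro _ ⟨α, β, -, hαβ, x, hx, y, hy, rfl⟩
    exact h.conj_mem_commutator hαβ hx hy

/-- The commutators of elements of opposite root subgroups `P α` and `Q (-α)` are central modulo
the normal closure of the subgroups `K δ`. For `γ ≠ ±α` this is the three subgroups lemma, and
`E (±α)` is contained in the subgroup generated by the `E γ`, `γ ≠ ±α`. -/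
theorem commutator_commutator_le (h : MixedSystem rt E P Q K) {α β : Φ}
    (hαβ : rt α + rt β = 0) :
    ⁅⁅P α, Q β⁆, ⊤⁆ ≤ Subgroup.normalClosure (span K Set.univ : Set G) := by
  set N := Subgroup.normalClosure (span K Set.univ : Set G) with hN
  have hKN : span K Set.univ ≤ N := Subgroup.subset_normalClosure
  have hβα : rt β = -rt α := eq_neg_of_add_eq_zero_right hαβ
  have hPQ : ∀ γ δ, rt γ + rt δ ≠ 0 → ⁅P γ, Q δ⁆ ≤ N := fun γ δ h0 =>
    (h.PQ γ δ h0).trans ((span_mono (Set.subset_univ _)).trans hKN)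
  have hsmul : ∀ γ, (rt γ ≠ rt α ∧ rt γ ≠ -rt α) → ∀ m : ℤ, 0 < m → m • rt γ ≠ 0 :=
    fun γ hγ m hm h0 => (h.reduced γ α m 0 hm (by rw [h0, zero_smul])).elim hγ.1 hγ.2
  have hfar : ∀ γ, (rt γ ≠ rt α ∧ rt γ ≠ -rt α) → ⁅⁅P α, Q β⁆, E γ⁆ ≤ N := by
    intro γ hγ
    apply commutator_commutator_le_of_rotate
    · have h1 : ⁅Q β, E γ⁆ ≤ span Q (cone rt β γ) :=
        h.EQ.symm β γ fun h0 => hγ.1 (by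
          rw [hβα, neg_add_eq_zero] at h0; exact h0.symm)
      refine (Subgroup.commutator_mono h1 le_rfl).trans ?_
      rw [← Subgroup.closure_eq (P α), span]
      refine commutator_closure_le ?_
      rintro s ⟨δ, hδ, hs⟩ t ht
      have h0 : rt α + rt δ ≠ 0 := by
        rcases hδ with hδ | hδ | hδ
        · intro h0
          exact hsmul γ hγ 1 one_pos (by rw [← h0, hδ, hβα]; module)
        · intro h0
          refine hγ.1 (sub_eq_zero.1 ?_)
          rw [← h0, hδ, hβα]; module
        · intro h0
          exact hsmul γ hγ 2 two_pos (by rw [← h0, hδ, hβα]; module)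
      rw [← commutatorElement_inv]
      exact N.inv_mem (hPQ α δ h0 (Subgroup.commutator_mem_commutator ht hs))
    · have h1 : ⁅E γ, P α⁆ ≤ span P (cone rt γ α) :=
        h.EP γ α fun h0 => hγ.2 (eq_neg_of_add_eq_zero_left h0)
      refine (Subgroup.commutator_mono h1 le_rfl).trans ?_
      rw [← Subgroup.closure_eq (Q β), span]
      refine commutator_closure_le ?_
      rintro s ⟨δ, hδ, hs⟩ t ht
      have h0 : rt δ + rt β ≠ 0 := by
        rcases hδ with hδ | hδ | hδ
        · intro h0
          exact hsmul γ hγ 1 one_pos (by rw [← h0, hδ, hβα]; module)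
        · intro h0
          exact hsmul γ hγ 2 two_pos (by rw [← h0, hδ, hβα]; module)
        · intro h0
          refine hγ.2 (eq_neg_of_add_eq_zero_left ?_)
          rw [← h0, hδ, hβα]; module
      exact hPQ δ β h0 (Subgroup.commutator_mem_commutator hs ht)
  let C : Subgroup G := (Subgroup.centralizer
    (⁅P α, Q β⁆.map (QuotientGroup.mk' N) : Set (G ⧸ N))).comap (QuotientGroup.mk' N)
  have hC : ∀ L : Subgroup G, ⁅⁅P α, Q β⁆, L⁆ ≤ N ↔ L ≤ C := by
    intro L
    have e : ⁅⁅P α, Q β⁆, L⁆ ≤ N ↔ ⁅⁅P α, Q β⁆, L⁆.map (QuotientGroup.mk' N) = ⊥ := by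
      rw [Subgroup.map_eq_bot_iff, QuotientGroup.ker_mk']
    rw [e, Subgroup.map_commutator, Subgroup.commutator_comm,
      Subgroup.commutator_eq_bot_iff_le_centralizer, Subgroup.map_le_iff_le_comap]
  rw [hC, ← h.span_E]
  refine span_le.2 fun γ _ => ?_
  -- `E (±α)` is generated by commutators of elements of the other root subgroups
  by_cases hγ : rt γ ≠ rt α ∧ rt γ ≠ -rt α
  · exact (hC _).1 (hfar γ hγ)
  have hγ' : rt γ = rt α ∨ rt γ = -rt α := by tauto
  refine (h.le_E γ).trans ?_
  rw [commutatorsAvoiding, Subgroup.closure_le]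
  have hCE : ∀ δ, (rt δ ≠ rt γ ∧ rt δ ≠ -rt γ) → E δ ≤ C := by
    intro δ hδ
    refine (hC _).1 (hfar δ ?_)
    rcases hγ' with e | e <;> rw [e] at hδ
    · exact hδ
    · rw [neg_neg] at hδ
      exact hδ.symm
  rintro _ ⟨δ, ε, hδ, hε, u, hu, w, hw, rfl⟩
  exact Subgroup.commutator_le_self C
    (Subgroup.commutator_mem_commutator (hCE δ hδ hu) (hCE ε hε hw))

/-- The mixed commutator subgroup is central modulo the normal closure of the `K δ`. -/
theorem commutator_top_le (h : MixedSystem rt E P Q K) :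
    ⁅⁅span P Set.univ, span Q Set.univ⁆, ⊤⁆ ≤
      Subgroup.normalClosure (span K Set.univ : Set G) := by
  set N := Subgroup.normalClosure (span K Set.univ : Set G) with hN
  let Z : Subgroup G := (Subgroup.center (G ⧸ N)).comap (QuotientGroup.mk' N)
  have hZ : ∀ L : Subgroup G, (⁅L, ⊤⁆ : Subgroup G) ≤ N ↔ L ≤ Z := by
    intro L
    have e : (⁅L, ⊤⁆ : Subgroup G) ≤ N ↔ (⁅L, ⊤⁆ : Subgroup G).map (QuotientGroup.mk' N) = ⊥ := by
      rw [Subgroup.map_eq_bot_iff, QuotientGroup.ker_mk']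
    rw [e, Subgroup.map_commutator, Subgroup.map_top_of_surjective _ (QuotientGroup.mk'_surjective N),
      Subgroup.commutator_top_right_eq_bot_iff_le_center, Subgroup.map_le_iff_le_comap]
  have hNZ : N ≤ Z := (hZ N).1 (Subgroup.commutator_le_left N ⊤)
  rw [hZ]
  refine commutator_closure_le ?_
  rintro s ⟨α, -, hs⟩ t ⟨β, -, ht⟩
  have hst := Subgroup.commutator_mem_commutator hs ht
  by_cases h0 : rt α + rt β = 0
  · exact (hZ _).1 (h.commutator_commutator_le h0) hst
  · exact hNZ (Subgroup.subset_normalClosure (span_mono (Set.subset_univ _) (h.PQ α β h0 hst)))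

theorem commutator_normal [Nonempty Φ] (h : MixedSystem rt E P Q K) :
    ⁅span P Set.univ, span Q Set.univ⁆.Normal :=
  Subgroup.commutator_top_right_le_iff.1
    (h.commutator_top_le.trans (h.normalClosure_le_commutator (Classical.arbitrary Φ)))

/-- To commute the conjugate `y x y⁻¹`, where `x ∈ P α` and `y ∈ E (-α)`, with an element of `Q β`,
conjugate by `y`; this works unless `β = α`, and for each `β` the conjugates with `α ≠ β` are
sufficient to generate the normal closure. -/
theorem commutator_normalClosure [Nonempty Φ] (h : MixedSystem rt E P Q K) :
    ⁅Subgroup.normalClosure (span P Set.univ : Set G),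
      Subgroup.normalClosure (span Q Set.univ : Set G)⁆ = ⁅span P Set.univ, span Q Set.univ⁆ := by
  have hH := h.commutator_normal
  set H := ⁅span P Set.univ, span Q Set.univ⁆ with hHdef
  refine le_antisymm ?_ (Subgroup.commutator_mono Subgroup.subset_normalClosure
    Subgroup.subset_normalClosure)
  have key : ∀ β, ⁅Subgroup.normalClosure (span P Set.univ : Set G), Q β⁆ ≤ H := by
    intro β
    obtain ⟨T, hT, hTβ, hgen⟩ := h.exists_gen β
    refine (Subgroup.commutator_mono
      (normalClosure_le h.reduced h.congr h.EE h.EP hT hgen) le_rfl).trans ?_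
    rw [← Subgroup.closure_eq (span P Set.univ), ← Subgroup.closure_union,
      ← Subgroup.closure_eq (Q β)]
    refine commutator_closure_le ?_
    rintro z (hz | ⟨α, γ, hγ, -, x, hx, y, hy, rfl⟩) w hw
    · exact Subgroup.commutator_mem_commutator hz (mem_span (Set.mem_univ _) hw)
    · have h1 : y⁻¹ * w * y⁻¹⁻¹ ∈ span Q Set.univ :=
        h.EQ.conj_mem_univ (hTβ γ hγ) (inv_mem hy) hw
      have e : ⁅y * x * y⁻¹, w⁆ = y * ⁅x, y⁻¹ * w * y⁻¹⁻¹⁆ * y⁻¹ := by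
        simp only [commutatorElement_def]; group
      rw [e]
      exact hH.conj_mem _
        (Subgroup.commutator_mem_commutator (mem_span (Set.mem_univ _) hx) h1) y
  -- since `H` is normal, it is enough to commute with `Q` itself
  rw [Subgroup.normalClosure, Subgroup.normalClosure]
  refine commutator_closure_le fun s hs t ht => ?_
  obtain ⟨b, hb, hbt⟩ := Group.mem_conjugatesOfSet_iff.1 ht
  obtain ⟨g, rfl⟩ := isConj_iff.1 hbt
  have hs' : g⁻¹ * s * g⁻¹⁻¹ ∈ Subgroup.normalClosure (span P Set.univ : Set G) :=
    Subgroup.normalClosure_normal.conj_mem _ (Subgroup.conjugatesOfSet_subset_normalClosure hs) _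
  have h1 : ⁅g⁻¹ * s * g⁻¹⁻¹, b⁆ ∈ H := by
    have : ⁅Subgroup.normalClosure (span P Set.univ : Set G), span Q Set.univ⁆ ≤ H := by
      rw [← Subgroup.closure_eq (Subgroup.normalClosure (span P Set.univ : Set G)), span]
      refine commutator_closure_le ?_
      rintro u hu w ⟨β, -, hw⟩
      exact key β (Subgroup.commutator_mem_commutator hu hw)
    exact this (Subgroup.commutator_mem_commutator hs' hb)
  have e : ⁅s, g * b * g⁻¹⁆ = g * ⁅g⁻¹ * s * g⁻¹⁻¹, b⁆ * g⁻¹ := by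
    simp only [commutatorElement_def]; group
  rw [e]
  exact hH.conj_mem _ h1 g

end MixedSystem

end RootGroups

/-! ### Products of form ideals -/

namespace BakUnitary

variable {A : Type*} [Ring A] [StarRing A]

namespace FormRing

variable (F : FormRing A)

theorem lam_comm (a : A) : F.lam * a = a * F.lam :=
  (Subring.mem_center_iff.mp F.lam_central a).symm

theorem star_lam_comm (a : A) : star F.lam * a = a * star F.lam := by
  have := congrArg star (F.lam_comm (star a))
  simpa using this.symm

/-- The "trace" map `c ↦ c - λ c̄`; its values on `I` lie in every relative form parameter of
level `I`. -/
def tr : A →+ A where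
  toFun c := c - F.lam * star c
  map_zero' := by simp
  map_add' a b := by simp only [star_add, mul_add]; abel

theorem tr_apply (c : A) : F.tr c = c - F.lam * star c := rfl

theorem conj_tr (c k : A) : c * F.tr k * star c = F.tr (c * k * star c) := by
  simp only [tr_apply, mul_sub, sub_mul, star_mul, star_star, mul_assoc]
  rw [← mul_assoc c F.lam, ← F.lam_comm c, mul_assoc]

end FormRing

namespace FormIdeal

variable {F : FormRing A}

theorem gam_le_lam (X : FormIdeal F) {p : A} (hp : p ∈ X.Gam) : p ∈ F.Lam := (X.subset_max hp).2

theorem gam_le_I (X : FormIdeal F) {p : A} (hp : p ∈ X.Gam) : p ∈ X.I := (X.subset_max hp).1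

theorem star_eq_of_mem (X : FormIdeal F) {p : A} (hp : p ∈ X.Gam) : F.lam * star p = -p := by
  have : p = -(F.lam * star p) := F.subset_max (X.gam_le_lam hp)
  rw [eq_neg_iff_add_eq_zero, add_comm] at this
  exact eq_neg_of_add_eq_zero_left this

theorem tr_mem (X : FormIdeal F) {a : A} (ha : a ∈ X.I) : F.tr a ∈ X.Gam :=
  X.min_subset (AddSubgroup.mem_sup_left (AddSubgroup.subset_closure ⟨a, ha, rfl⟩))

theorem conj_lam_mem (X : FormIdeal F) {a c : A} (ha : a ∈ X.I) (hc : c ∈ F.Lam) :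
    a * c * star a ∈ X.Gam :=
  X.min_subset (AddSubgroup.mem_sup_right (AddSubgroup.subset_closure ⟨a, ha, c, hc, rfl⟩))

/-- The unit form ideal `(A, Λ)`. -/
def top (F : FormRing A) : FormIdeal F where
  I := ⊤
  star_mem _ _ := trivial
  Gam := F.Lam
  min_subset := by
    have : F.gammaMin ⊤ ≤ F.Lam := by
      refine sup_le ?_ ?_ <;> rw [AddSubgroup.closure_le]
      · rintro _ ⟨a, -, rfl⟩
        exact F.min_subset ⟨a, rfl⟩
      · rintro _ ⟨a, -, c, hc, rfl⟩
        exact F.conj_mem a c hc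
    exact this
  subset_max _ hp := ⟨trivial, hp⟩
  conj_mem := F.conj_mem

/-- The symmetrized product `IJ + JI`, as an additive subgroup. -/
def mulAddSubgroup (X Y : FormIdeal F) : AddSubgroup A :=
  AddSubgroup.closure {x | ∃ a ∈ X.I, ∃ b ∈ Y.I, x = a * b ∨ x = b * a}

/-- The additive subgroup generated by the traces `k - λ k̄`, `k ∈ IJ + JI`, and by the elements
`b γ b̄`, `a δ ā` with `a ∈ I`, `b ∈ J`, `γ ∈ Γ`, `δ ∈ Δ`. -/
def mulGam (X Y : FormIdeal F) : AddSubgroup A :=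
  (X.mulAddSubgroup Y).map F.tr ⊔
    (AddSubgroup.closure {x | ∃ b ∈ Y.I, ∃ p ∈ X.Gam, x = b * p * star b} ⊔
     AddSubgroup.closure {x | ∃ a ∈ X.I, ∃ p ∈ Y.Gam, x = a * p * star a})

section Product

variable (X Y : FormIdeal F)

theorem mul_mem_mulAddSubgroup {X Y : FormIdeal F} {a b : A} (ha : a ∈ X.I) (hb : b ∈ Y.I) :
    a * b ∈ X.mulAddSubgroup Y :=
  AddSubgroup.subset_closure ⟨a, ha, b, hb, Or.inl rfl⟩

theorem mul_mem_mulAddSubgroup' {X Y : FormIdeal F} {a b : A} (ha : a ∈ X.I) (hb : b ∈ Y.I) :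
    b * a ∈ X.mulAddSubgroup Y :=
  AddSubgroup.subset_closure ⟨a, ha, b, hb, Or.inr rfl⟩

theorem mulAddSubgroup_le {X Y : FormIdeal F} {S : AddSubgroup A}
    (h : ∀ a ∈ X.I, ∀ b ∈ Y.I, a * b ∈ S ∧ b * a ∈ S) : X.mulAddSubgroup Y ≤ S := by
  rw [mulAddSubgroup, AddSubgroup.closure_le]
  rintro _ ⟨a, ha, b, hb, rfl | rfl⟩
  · exact (h a ha b hb).1
  · exact (h a ha b hb).2

theorem left_mul_mem_mulAddSubgroup {x : A} (c : A) (hx : x ∈ X.mulAddSubgroup Y) :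
    c * x ∈ X.mulAddSubgroup Y := by
  have : X.mulAddSubgroup Y ≤ (X.mulAddSubgroup Y).comap (AddMonoidHom.mulLeft c) :=
    mulAddSubgroup_le fun a ha b hb => by
      constructor
      · change c * (a * b) ∈ X.mulAddSubgroup Y
        rw [← mul_assoc]
        exact mul_mem_mulAddSubgroup (X.I.mul_mem_left c a ha) hb
      · change c * (b * a) ∈ X.mulAddSubgroup Y
        rw [← mul_assoc]
        exact mul_mem_mulAddSubgroup' ha (Y.I.mul_mem_left c b hb)
  exact this hx

theorem mul_right_mem_mulAddSubgroup {x : A} (c : A) (hx : x ∈ X.mulAddSubgroup Y) :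
    x * c ∈ X.mulAddSubgroup Y := by
  have : X.mulAddSubgroup Y ≤ (X.mulAddSubgroup Y).comap (AddMonoidHom.mulRight c) :=
    mulAddSubgroup_le fun a ha b hb => by
      constructor
      · change a * b * c ∈ X.mulAddSubgroup Y
        rw [mul_assoc]
        exact mul_mem_mulAddSubgroup ha (Y.I.mul_mem_right b c hb)
      · change b * a * c ∈ X.mulAddSubgroup Y
        rw [mul_assoc]
        exact mul_mem_mulAddSubgroup' (X.I.mul_mem_right a c ha) hb
  exact this hx

theorem star_mem_mulAddSubgroup {x : A} (hx : x ∈ X.mulAddSubgroup Y) :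
    star x ∈ X.mulAddSubgroup Y := by
  have : X.mulAddSubgroup Y ≤ (X.mulAddSubgroup Y).comap
      (starAddEquiv : A ≃+ A).toAddMonoidHom :=
    mulAddSubgroup_le fun a ha b hb => by
      constructor
      · change star (a * b) ∈ X.mulAddSubgroup Y
        rw [star_mul]
        exact mul_mem_mulAddSubgroup' (X.star_mem a ha) (Y.star_mem b hb)
      · change star (b * a) ∈ X.mulAddSubgroup Y
        rw [star_mul]
        exact mul_mem_mulAddSubgroup (X.star_mem a ha) (Y.star_mem b hb)
  exact this hx

theorem tr_mem_mulGam {X Y : FormIdeal F} {k : A} (hk : k ∈ X.mulAddSubgroup Y) :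
    F.tr k ∈ X.mulGam Y :=
  AddSubgroup.mem_sup_left ⟨k, hk, rfl⟩

theorem conj_mem_mulGam {X Y : FormIdeal F} {b p : A} (hb : b ∈ Y.I) (hp : p ∈ X.Gam) :
    b * p * star b ∈ X.mulGam Y :=
  AddSubgroup.mem_sup_right (AddSubgroup.mem_sup_left
    (AddSubgroup.subset_closure ⟨b, hb, p, hp, rfl⟩))

theorem conj_mem_mulGam' {X Y : FormIdeal F} {a p : A} (ha : a ∈ X.I) (hp : p ∈ Y.Gam) :
    a * p * star a ∈ X.mulGam Y :=
  AddSubgroup.mem_sup_right (AddSubgroup.mem_sup_right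
    (AddSubgroup.subset_closure ⟨a, ha, p, hp, rfl⟩))

theorem mulGam_le {X Y : FormIdeal F} {S : AddSubgroup A}
    (h1 : ∀ k ∈ X.mulAddSubgroup Y, F.tr k ∈ S)
    (h2 : ∀ b ∈ Y.I, ∀ p ∈ X.Gam, b * p * star b ∈ S)
    (h3 : ∀ a ∈ X.I, ∀ p ∈ Y.Gam, a * p * star a ∈ S) : X.mulGam Y ≤ S := by
  refine sup_le ?_ (sup_le ?_ ?_)
  · rintro _ ⟨k, hk, rfl⟩
    exact h1 k hk
  · rw [AddSubgroup.closure_le]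
    rintro _ ⟨b, hb, p, hp, rfl⟩
    exact h2 b hb p hp
  · rw [AddSubgroup.closure_le]
    rintro _ ⟨b, hb, p, hp, rfl⟩
    exact h3 b hb p hp

/-- The cross terms of `(k + l) c (k + l)‾` add up to the trace of `k c l̄`, since `λ c̄ = -c`. -/
theorem conj_lam_mem_mulGam {k c : A} (hk : k ∈ X.mulAddSubgroup Y) (hc : c ∈ F.Lam) :
    k * c * star k ∈ X.mulGam Y := by
  induction hk using AddSubgroup.closure_induction with
  | mem x hx =>
    obtain ⟨a, ha, b, hb, rfl | rfl⟩ := hx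
    · have := conj_mem_mulGam' (X := X) (Y := Y) ha (Y.conj_lam_mem hb hc)
      simpa only [star_mul, mul_assoc] using this
    · have := conj_mem_mulGam (X := X) (Y := Y) hb (X.conj_lam_mem ha hc)
      simpa only [star_mul, mul_assoc] using this
  | zero => simp
  | add x y hx hy hx' hy' =>
    have e : (x + y) * c * star (x + y) =
        x * c * star x + y * c * star y + F.tr (x * c * star y) := by
      have h1 : F.lam * (y * (star c * star x)) = -(y * (c * star x)) := by
        rw [← mul_assoc, F.lam_comm, mul_assoc, ← mul_assoc F.lam,
          (top F).star_eq_of_mem hc]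
        simp
      simp only [FormRing.tr_apply, star_add, star_mul, star_star, mul_add, add_mul, mul_assoc, h1]
      abel
    rw [e]
    refine add_mem (add_mem hx' hy') (tr_mem_mulGam ?_)
    exact mul_right_mem_mulAddSubgroup X Y _ (mul_right_mem_mulAddSubgroup X Y _ hx)
  | neg x _ hx => simpa using hx

/-- The two-sided ideal `IJ + JI`. -/
def mulIdeal : TwoSidedIdeal A :=
  .mk' (X.mulAddSubgroup Y) (zero_mem _) add_mem neg_mem
    (fun hx => left_mul_mem_mulAddSubgroup X Y _ hx)
    (fun hx => mul_right_mem_mulAddSubgroup X Y _ hx)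

theorem mem_mulIdeal {x : A} : x ∈ X.mulIdeal Y ↔ x ∈ X.mulAddSubgroup Y := by
  rw [mulIdeal, TwoSidedIdeal.mem_mk', SetLike.mem_coe]

/-- The symmetrized product of form ideals: the ideal `IJ + JI` with the relative form
parameter `mulGam`. -/
def mul : FormIdeal F where
  I := X.mulIdeal Y
  star_mem a ha := by
    rw [mem_mulIdeal] at ha ⊢
    exact star_mem_mulAddSubgroup X Y ha
  Gam := X.mulGam Y
  min_subset := by
    have : F.gammaMin (X.mulIdeal Y) ≤ X.mulGam Y := by
      refine sup_le ?_ ?_ <;> rw [AddSubgroup.closure_le]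
      · rintro _ ⟨a, ha, rfl⟩
        rw [mem_mulIdeal] at ha
        exact tr_mem_mulGam ha
      · rintro _ ⟨a, ha, c, hc, rfl⟩
        rw [mem_mulIdeal] at ha
        exact conj_lam_mem_mulGam X Y ha hc
    exact this
  subset_max := by
    have h1 : X.mulGam Y ≤ X.mulAddSubgroup Y := by
      refine mulGam_le (fun k hk => ?_) (fun b hb p hp => ?_) (fun a ha p hp => ?_)
      · exact sub_mem hk (left_mul_mem_mulAddSubgroup X Y _ (star_mem_mulAddSubgroup X Y hk))
      · exact mul_right_mem_mulAddSubgroup X Y _ (mul_mem_mulAddSubgroup' (X.gam_le_I hp) hb)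
      · exact mul_right_mem_mulAddSubgroup X Y _ (mul_mem_mulAddSubgroup ha (Y.gam_le_I hp))
    have h2 : X.mulGam Y ≤ F.Lam :=
      mulGam_le (fun k _ => F.min_subset ⟨k, rfl⟩)
        (fun b _ p hp => F.conj_mem b p (X.gam_le_lam hp))
        (fun a _ p hp => F.conj_mem a p (Y.gam_le_lam hp))
    intro p hp
    exact ⟨(mem_mulIdeal X Y).2 (h1 hp), h2 hp⟩
  conj_mem c := by
    have : X.mulGam Y ≤ (X.mulGam Y).comap
        ((AddMonoidHom.mulRight (star c)).comp (AddMonoidHom.mulLeft c)) := by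
      refine mulGam_le (fun k hk => ?_) (fun b hb p hp => ?_) (fun a ha p hp => ?_)
      · change c * F.tr k * star c ∈ X.mulGam Y
        rw [F.conj_tr]
        exact tr_mem_mulGam (mul_right_mem_mulAddSubgroup X Y _
          (left_mul_mem_mulAddSubgroup X Y _ hk))
      · change c * (b * p * star b) * star c ∈ X.mulGam Y
        have := conj_mem_mulGam (X := X) (Y := Y) (Y.I.mul_mem_left c b hb) hp
        simpa only [star_mul, mul_assoc] using this
      · change c * (a * p * star a) * star c ∈ X.mulGam Y
        have := conj_mem_mulGam' (X := X) (Y := Y) (X.I.mul_mem_left c a ha) hp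
        simpa only [star_mul, mul_assoc] using this
    exact fun x hx => this hx

theorem mem_mul_I {x : A} : x ∈ (X.mul Y).I ↔ x ∈ X.mulAddSubgroup Y :=
  mem_mulIdeal X Y

theorem mul_top_I {x : A} (hx : x ∈ (X.mul (top F)).I) : x ∈ X.I := by
  have h : X.mulAddSubgroup (top F) ≤ X.I.asIdeal.toAddSubgroup :=
    mulAddSubgroup_le fun a ha b _ => ⟨X.I.mul_mem_right a b ha, X.I.mul_mem_left b a ha⟩
  exact h ((mem_mul_I X _).1 hx)

theorem mul_top_Gam {x : A} (hx : x ∈ (X.mul (top F)).Gam) : x ∈ X.Gam := by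
  have h : X.mulGam (top F) ≤ X.Gam :=
    mulGam_le (fun k hk => X.tr_mem (mul_top_I X ((mem_mul_I X _).2 hk)))
      (fun b _ p hp => X.conj_mem b p hp) (fun a ha p hp => X.conj_lam_mem ha hp)
  exact h hx

theorem mulAddSubgroup_comm : X.mulAddSubgroup Y = Y.mulAddSubgroup X :=
  le_antisymm
    (mulAddSubgroup_le fun _ ha _ hb => ⟨mul_mem_mulAddSubgroup' hb ha, mul_mem_mulAddSubgroup hb ha⟩)
    (mulAddSubgroup_le fun _ ha _ hb => ⟨mul_mem_mulAddSubgroup' hb ha, mul_mem_mulAddSubgroup hb ha⟩)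

theorem mulGam_comm : X.mulGam Y = Y.mulGam X := by
  rw [mulGam, mulGam, mulAddSubgroup_comm, sup_comm (AddSubgroup.closure _)]

end Product

end FormIdeal

end BakUnitary

/-! ### Relations between elementary transvections -/

namespace BakUnitary

open scoped commutatorElement

namespace Idx

variable {n : ℕ}

theorem opp_inj {i j : Idx n} : i.opp = j.opp ↔ i = j :=
  ⟨fun h => by rw [← i.opp_opp, h, j.opp_opp], congrArg _⟩

theorem opp_eq_iff {i j : Idx n} : i.opp = j ↔ i = j.opp :=
  ⟨fun h => by rw [← h, opp_opp], fun h => by rw [h, opp_opp]⟩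

end Idx

section Unipotent

variable {R : Type*} [Ring R]

theorem unipotent_congr {N M : R} (h : N = M) (hN : N * N = 0) (hM : M * M = 0) :
    unipotent N hN = unipotent M hM := by
  subst h; rfl

/-- The commutator of `1 + N` and `1 + M` if `N² = M² = NMN = 0`. -/
theorem val_commutator_unipotent {N M : R} (hN : N * N = 0) (hM : M * M = 0)
    (h : N * M * N = 0) :
    ((⁅unipotent N hN, unipotent M hM⁆ : Rˣ) : R) = 1 + (N * M - M * N) + M * N * M := by
  have e : ((⁅unipotent N hN, unipotent M hM⁆ : Rˣ) : R) = (1 + N) * (1 + M) * (1 - N) * (1 - M) := by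
    rw [commutatorElement_def]; rfl
  have h1 : N * (M * N) = 0 := by rw [← mul_assoc, h]
  have h2 : N * (M * (N * M)) = 0 := by rw [← mul_assoc M, ← mul_assoc N, h1, zero_mul]
  rw [e]
  simp only [add_mul, mul_add, sub_mul, mul_sub, mul_one, one_mul, mul_assoc, hN, hM, h1,
    mul_zero, add_zero]
  abel

theorem commutator_unipotent_eq_one {N M : R} (hN : N * N = 0) (hM : M * M = 0)
    (h : N * M = 0) (h' : M * N = 0) : ⁅unipotent N hN, unipotent M hM⁆ = 1 := by
  apply Units.ext
  rw [val_commutator_unipotent hN hM (by rw [h, zero_mul])]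
  simp [h, h']

end Unipotent

section Matrix

variable {R : Type*} [Ring R] {n : ℕ}

theorem longT_add (i : Idx n) (a b : R) : longT i (a + b) = longT i a * longT i b := by
  apply Units.ext
  change 1 + Matrix.single i i.opp (a + b) =
    (1 + Matrix.single i i.opp a) * (1 + Matrix.single i i.opp b)
  rw [Matrix.single_add, mul_add, add_mul, add_mul,
    Matrix.single_mul_single_of_ne _ _ _ _ (Idx.opp_ne i)]
  simp [add_assoc]

/-- The additive group `A` embedded as a long root subgroup. -/
def longHom (i : Idx n) : R →+ Additive (GL2n n R) :=
  AddMonoidHom.mk' (fun a => Additive.ofMul (longT i a)) (longT_add i)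

theorem longT_zero (i : Idx n) : longT i (0 : R) = 1 := (longHom i).map_zero

theorem longT_neg (i : Idx n) (a : R) : longT i (-a) = (longT i a)⁻¹ := (longHom i).map_neg a

theorem commutator_long_long {i k : Idx n} (h : i.opp ≠ k) (p q : R) :
    ⁅longT i p, longT k q⁆ = 1 := by
  have h' : k.opp ≠ i := fun e => h (by rw [← e, Idx.opp_opp])
  refine commutator_unipotent_eq_one _ _ ?_ ?_
  · simp [h]
  · simp [h']

end Matrix

variable {A : Type*} [Ring A] [StarRing A]

namespace FormRing

variable (F : FormRing A) {n : ℕ}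

/-- The central unit `λ` for a positive and `1` for a negative index: the coefficients
`λ^{(ε(j) - ε(i)) / 2}` of the transvections are `(mu i)⁻¹ * mu j`, and those of the
long root form parameters `λ^{-(ε(i) + 1) / 2} Λ` are `(mu i)⁻¹`. -/
def mu (i : Idx n) : Aˣ := Sum.elim (fun _ => F.lamUnit) (fun _ => 1) i

theorem lamUnit_zpow_long (i : Idx n) : F.lamUnit ^ (-((i.sgn + 1) / 2)) = (F.mu i)⁻¹ := by
  rcases i with i | i <;> simp [Idx.sgn, mu]

theorem mu_comm (i : Idx n) (a : A) : (F.mu i : A) * a = a * (F.mu i : A) := by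
  rcases i with i | i
  · exact F.lam_comm a
  · simp [mu]

theorem mu_inv_comm (i : Idx n) (a : A) :
    (((F.mu i)⁻¹ : Aˣ) : A) * a = a * (((F.mu i)⁻¹ : Aˣ) : A) := by
  rcases i with i | i
  · exact F.star_lam_comm a
  · simp [mu]

theorem star_mu (i : Idx n) : star (F.mu i : A) = (((F.mu i)⁻¹ : Aˣ) : A) := by
  rcases i with i | i
  · rfl
  · simp [mu]

theorem star_mu_inv (i : Idx n) : star (((F.mu i)⁻¹ : Aˣ) : A) = (F.mu i : A) := by
  rw [← star_mu, star_star]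

theorem mu_opp (i : Idx n) : F.mu i.opp = F.lamUnit * (F.mu i)⁻¹ := by
  rcases i with i | i <;> simp [mu, Idx.opp]

theorem mu_units_comm (i : Idx n) (u : Aˣ) : F.mu i * u = u * F.mu i := Units.ext (F.mu_comm i _)

/-- The coefficient `λ^{(ε(j) - ε(i)) / 2}`. -/
def kap (i j : Idx n) : Aˣ := (F.mu i)⁻¹ * F.mu j

theorem lamUnit_zpow_short (i j : Idx n) : F.lamUnit ^ ((j.sgn - i.sgn) / 2) = F.kap i j := by
  rcases i with i | i <;> rcases j with j | j <;> simp [Idx.sgn, kap, mu]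

theorem kap_comm (i j : Idx n) (a : A) : (F.kap i j : A) * a = a * (F.kap i j : A) := by
  rw [kap, Units.val_mul, mul_assoc, F.mu_comm, ← mul_assoc, F.mu_inv_comm, mul_assoc]

theorem star_kap (i j : Idx n) : star (F.kap i j : A) = (((F.kap i j)⁻¹ : Aˣ) : A) := by
  rw [kap, Units.val_mul, star_mul, star_mu, star_mu_inv, mul_inv_rev, inv_inv, Units.val_mul]

theorem kap_mul (i j k : Idx n) : F.kap j k * F.kap i j = F.kap i k := by
  have : F.kap j k * F.kap i j = F.kap i j * F.kap j k := Units.ext (F.kap_comm j k _)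
  rw [this, kap, kap, kap, mul_assoc, mul_inv_cancel_left]

theorem kap_mul_mu (i j : Idx n) : F.kap i j * F.mu i = F.mu j := by
  rw [← F.mu_units_comm, kap, mul_inv_cancel_left]

theorem mu_opp_inv (i : Idx n) : (F.mu i.opp)⁻¹ = F.lamUnit⁻¹ * F.mu i := by
  rw [mu_opp, mul_inv_rev, inv_inv, F.mu_units_comm]

theorem kap_opp_mul_mu_inv (i j : Idx n) : F.kap i.opp j * (F.mu i)⁻¹ = (F.mu j.opp)⁻¹ := by
  rw [kap, mu_opp_inv, mu_opp_inv, mul_assoc, mul_assoc, F.mu_units_comm j,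
    mul_inv_cancel_left]

theorem kap_opp (i j : Idx n) : F.kap j.opp i.opp = F.kap i j := by
  rw [kap, kap, mu_opp, mu_opp, mul_inv_rev, inv_inv, mul_assoc, inv_mul_cancel_left,
    F.mu_units_comm]

theorem shortNil_eq (i j : Idx n) (c : A) : F.shortNil i j c =
    Matrix.single i j c - Matrix.single j.opp i.opp ((F.kap i j : A) * star c) := by
  rw [shortNil, lamUnit_zpow_short]

theorem shortNil_add (i j : Idx n) (a b : A) :
    F.shortNil i j (a + b) = F.shortNil i j a + F.shortNil i j b := by
  simp only [shortNil_eq, star_add, mul_add, Matrix.single_add]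
  abel

theorem shortNil_mul {i j : Idx n} (h : i ≠ j) (a b : A) :
    F.shortNil i j a * F.shortNil i j b = 0 := by
  have h1 : i.opp ≠ j.opp := fun e => h (Idx.opp_inj.1 e)
  simp [shortNil, mul_sub, sub_mul, Matrix.single_mul_single_of_ne, h.symm, h1,
    (Idx.opp_ne j).symm, Idx.opp_ne i]

theorem shortT_add {i j : Idx n} (h : i ≠ j) (a b : A) :
    F.shortT i j h (a + b) = F.shortT i j h a * F.shortT i j h b := by
  apply Units.ext
  change 1 + F.shortNil i j (a + b) = (1 + F.shortNil i j a) * (1 + F.shortNil i j b)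
  rw [shortNil_add, mul_add, add_mul, add_mul, F.shortNil_mul h]
  simp [add_assoc]

/-- The additive group `A` embedded as a short root subgroup. -/
def shortHom {i j : Idx n} (h : i ≠ j) : A →+ Additive (GL2n n A) :=
  AddMonoidHom.mk' (fun a => Additive.ofMul (F.shortT i j h a)) (F.shortT_add h)

theorem shortT_zero {i j : Idx n} (h : i ≠ j) : F.shortT i j h 0 = 1 := (F.shortHom h).map_zero

theorem shortT_neg {i j : Idx n} (h : i ≠ j) (a : A) :
    F.shortT i j h (-a) = (F.shortT i j h a)⁻¹ := (F.shortHom h).map_neg a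

/-- Each short transvection has two presentations, for the index pairs `(i, j)`, `(-j, -i)`. -/
theorem shortT_opp {i j : Idx n} (h : i ≠ j) (h' : j.opp ≠ i.opp) (a : A) :
    F.shortT i j h a = F.shortT j.opp i.opp h' (-((F.kap i j : A) * star a)) := by
  refine unipotent_congr ?_ _ _
  have e : (F.kap i j : A) * star ((F.kap i j : A) * star a) = a := by
    rw [star_mul, star_star, star_kap, F.kap_comm, mul_assoc, Units.inv_mul, mul_one]
  rw [shortNil_eq, shortNil_eq, Idx.opp_opp, Idx.opp_opp, F.kap_opp, star_neg, mul_neg, e]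
  simp only [← Matrix.single_neg]
  abel

section Products

variable {i j l : Idx n}

theorem shortNil_mul_shortNil (hij : i ≠ j.opp) (hjl : j ≠ l.opp) (hil : i ≠ l) (a b : A) :
    F.shortNil i j a * F.shortNil j l b = Matrix.single i l (a * b) := by
  have h1 : i.opp ≠ j := fun h => hij (Idx.opp_eq_iff.1 h)
  simp [shortNil_eq, mul_sub, sub_mul, Idx.opp_inj, h1, hjl, hil]

theorem shortNil_mul_shortNil_rev (hij : i ≠ j.opp) (hjl : j ≠ l.opp) (hil : i ≠ l) (a b : A) :
    F.shortNil j l b * F.shortNil i j a =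
      Matrix.single l.opp i.opp ((F.kap i l : A) * star (a * b)) := by
  have h1 : j.opp ≠ i := fun h => hij h.symm
  have h2 : l ≠ j.opp := fun h => hjl (by rw [h, Idx.opp_opp])
  have e : (F.kap j l : A) * star b * ((F.kap i j : A) * star a) =
      (F.kap i l : A) * star (a * b) := by
    rw [mul_assoc, ← mul_assoc (star b), ← F.kap_comm, mul_assoc, ← mul_assoc, ← Units.val_mul,
      kap_mul, star_mul]
  simp [shortNil_eq, mul_sub, sub_mul, h1, hil.symm, h2, e]

end Products

theorem commutator_short_short {i j l : Idx n} (hij : i ≠ j) (hij' : i ≠ j.opp) (hjl : j ≠ l)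
    (hjl' : j ≠ l.opp) (hil : i ≠ l) (hil' : i ≠ l.opp) (a b : A) :
    ⁅F.shortT i j hij a, F.shortT j l hjl b⁆ = F.shortT i l hil (a * b) := by
  have e1 := F.shortNil_mul_shortNil hij' hjl' hil a b
  have e2 := F.shortNil_mul_shortNil_rev hij' hjl' hil a b
  have h1 : l ≠ i.opp := fun h => hil' (by rw [h, Idx.opp_opp])
  have h2 : l.opp ≠ i := fun h => hil' h.symm
  have e3 : F.shortNil i j a * F.shortNil j l b * F.shortNil i j a = 0 := by
    rw [e1]
    have h3 : l ≠ j.opp := fun h => hjl' (by rw [h, Idx.opp_opp])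
    simp [shortNil_eq, mul_sub, hil.symm, h3]
  have e4 : F.shortNil j l b * F.shortNil i j a * F.shortNil j l b = 0 := by
    rw [e2]
    have h3 : i.opp ≠ j := fun h => hij' (Idx.opp_eq_iff.1 h)
    simp [shortNil_eq, mul_sub, hil, h3, Idx.opp_inj]
  apply Units.ext
  rw [shortT, shortT, val_commutator_unipotent _ _ e3, e4, e1, e2, add_zero, ← shortNil_eq]
  rfl

theorem commutator_short_short_long {i j : Idx n} (hij : i ≠ j) (hij' : i ≠ j.opp)
    (hj : j ≠ i.opp) (a b : A) :
    ⁅F.shortT i j hij a, F.shortT j i.opp hj b⁆ =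
      longT i ((((F.mu i)⁻¹ : Aˣ) : A) * F.tr ((F.mu i : A) * (a * b))) := by
  have hji : j ≠ i.opp.opp := by rw [Idx.opp_opp]; exact hij.symm
  have e1 := F.shortNil_mul_shortNil hij' hji (Idx.opp_ne i).symm a b
  have e2 := F.shortNil_mul_shortNil_rev hij' hji (Idx.opp_ne i).symm a b
  rw [Idx.opp_opp] at e2
  have e3 : F.shortNil i j a * F.shortNil j i.opp b * F.shortNil i j a = 0 := by
    rw [e1]
    simp [shortNil_eq, mul_sub, Idx.opp_ne, Idx.opp_inj, hij]
  have e4 : F.shortNil j i.opp b * F.shortNil i j a * F.shortNil j i.opp b = 0 := by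
    rw [e2]
    simp [shortNil_eq, mul_sub, Idx.opp_opp, Idx.opp_ne, hj.symm]
  have e : a * b - (F.kap i i.opp : A) * star (a * b) =
      (((F.mu i)⁻¹ : Aˣ) : A) * F.tr ((F.mu i : A) * (a * b)) := by
    have h1 : star ((F.mu i : A) * (a * b)) = (((F.mu i)⁻¹ : Aˣ) : A) * star (a * b) := by
      rw [star_mul, star_mu, F.mu_inv_comm]
    rw [tr_apply, mul_sub, Units.inv_mul_cancel_left, h1, kap, mu_opp, Units.val_mul,
      Units.val_mul, mul_assoc, mul_assoc]
    rfl
  apply Units.ext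
  rw [shortT, shortT, val_commutator_unipotent _ _ e3, e4, e1, e2, add_zero, ← e,
    sub_eq_add_neg (Matrix.single _ _ _), Matrix.single_neg, ← Matrix.single_add,
    ← sub_eq_add_neg]
  rfl

theorem kap_mul_star (i l : Idx n) {p : A} (hp : F.lam * star p = -p) (b : A) :
    (F.kap i l : A) * star ((((F.mu i)⁻¹ : Aˣ) : A) * p * b) =
      -((((F.mu l.opp)⁻¹ : Aˣ) : A) * (star b * p)) := by
  have h1 : star p = -(((F.lamUnit⁻¹ : Aˣ) : A) * p) := by
    rw [← mul_neg, ← hp]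
    exact (Units.inv_mul_cancel_left F.lamUnit (star p)).symm
  have h2 : ((F.lamUnit⁻¹ : Aˣ) : A) * star b = star b * ((F.lamUnit⁻¹ : Aˣ) : A) :=
    F.star_lam_comm _
  rw [star_mul, star_mul, star_mu_inv, ← F.mu_comm, ← mul_assoc (star b), ← F.mu_comm,
    ← mul_assoc, ← mul_assoc, ← Units.val_mul, kap_mul_mu, h1, mu_opp_inv, Units.val_mul,
    mul_neg, mul_assoc, ← mul_assoc (star b), ← h2, ← mul_assoc, ← mul_assoc, ← F.mu_comm l]
  simp only [mul_assoc]

/-- For the roots `2e_i` and `-e_i - e_l`, two positive combinations are roots: their sum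
`e_i - e_l`, and `-2e_l`. -/
theorem commutator_long_short {i l : Idx n} (hil : i ≠ l) (hil' : i.opp ≠ l) {p : A}
    (hp : F.lam * star p = -p) (b : A) :
    ⁅longT i ((((F.mu i)⁻¹ : Aˣ) : A) * p), F.shortT i.opp l hil' b⁆ =
      F.shortT i l hil ((((F.mu i)⁻¹ : Aˣ) : A) * p * b) *
        longT l.opp (-((((F.mu l.opp)⁻¹ : Aˣ) : A) * (star b * p * b))) := by
  have h1 : i.opp ≠ l.opp := fun h => hil (Idx.opp_inj.1 h)
  have h2 : l ≠ i.opp := hil'.symm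
  have h3 : l.opp ≠ i := fun h => hil' (by rw [← h, Idx.opp_opp])
  set q := (((F.mu i)⁻¹ : Aˣ) : A) * p with hq
  have e1 : Matrix.single i i.opp q * F.shortNil i.opp l b = Matrix.single i l (q * b) := by
    simp [shortNil_eq, mul_sub, h1]
  have e2 : F.shortNil i.opp l b * Matrix.single i i.opp q =
      Matrix.single l.opp i.opp ((F.kap i l : A) * star (q * b)) := by
    have h4 : (F.kap i.opp l : A) * star b * q = ((F.mu l.opp)⁻¹ : Aˣ) * (star b * p) := by
      rw [hq, mul_assoc, ← mul_assoc (star b), ← F.mu_inv_comm, mul_assoc, ← mul_assoc,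
        ← Units.val_mul, kap_opp_mul_mu_inv]
    rw [F.kap_mul_star i l hp b, ← Matrix.single_neg]
    simp [shortNil_eq, sub_mul, hil.symm, Idx.opp_opp, h4]
  have e3 : Matrix.single i i.opp q * F.shortNil i.opp l b * Matrix.single i i.opp q = 0 := by
    rw [e1]
    simp [hil.symm]
  have e4 : F.shortNil i.opp l b * Matrix.single i i.opp q * F.shortNil i.opp l b =
      Matrix.single l.opp l ((F.kap i l : A) * star (q * b) * b) := by
    rw [e2]
    simp [shortNil_eq, mul_sub, h1]
  have e5 : F.shortNil i l (q * b) * Matrix.single l.opp l.opp.opp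
      (-((((F.mu l.opp)⁻¹ : Aˣ) : A) * (star b * p * b))) = 0 := by
    simp [shortNil_eq, sub_mul, (Idx.opp_ne l).symm, h1]
  have e6 : (F.kap i l : A) * star (q * b) * b =
      -((((F.mu l.opp)⁻¹ : Aˣ) : A) * (star b * p * b)) := by
    rw [F.kap_mul_star i l hp b, neg_mul, mul_assoc]
  apply Units.ext
  rw [longT, shortT, val_commutator_unipotent _ _ e3, e4, e1, e2, ← shortNil_eq, e6]
  change _ = (1 + F.shortNil i l (q * b)) * (1 + Matrix.single l.opp l.opp.opp _)
  rw [mul_add, mul_one, add_mul, one_mul, e5, Idx.opp_opp, add_zero]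

/-- Transvections whose index pairs are not linked commute. -/
theorem commutator_short_unlinked {i j k l : Idx n} (hij : i ≠ j) (hkl : k ≠ l) (h1 : j ≠ k)
    (h2 : l ≠ i) (h3 : j ≠ l.opp) (h4 : i ≠ k.opp) (a b : A) :
    ⁅F.shortT i j hij a, F.shortT k l hkl b⁆ = 1 := by
  have h3' : l ≠ j.opp := fun h => h3 (by rw [h, Idx.opp_opp])
  have h4' : k ≠ i.opp := fun h => h4 (by rw [h, Idx.opp_opp])
  refine commutator_unipotent_eq_one _ _ ?_ ?_
  · simp [shortNil_eq, mul_sub, sub_mul, h1, h3, h4'.symm, Idx.opp_inj, h2.symm]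
  · simp [shortNil_eq, mul_sub, sub_mul, h2, h4.symm, h3', Idx.opp_inj, h1.symm]

theorem commutator_long_short_unlinked {i k l : Idx n} (hkl : k ≠ l) (h1 : i.opp ≠ k)
    (h2 : l ≠ i) (p b : A) : ⁅longT i p, F.shortT k l hkl b⁆ = 1 := by
  have h1' : k.opp ≠ i := fun h => h1 (by rw [← h, Idx.opp_opp])
  refine commutator_unipotent_eq_one _ _ ?_ ?_
  · simp [shortNil_eq, mul_sub, h1, Idx.opp_inj, h2.symm]
  · simp [shortNil_eq, sub_mul, h2, h1']

end FormRing

end BakUnitary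

/-! ### Roots and root subgroups -/

namespace BakUnitary

open scoped commutatorElement

open RootGroups

/-- The pairs of indices `i ≠ j`, which index the root subgroups. The pairs `(i, j)` and
`(-j, -i)` belong to the same root. -/
abbrev Root (n : ℕ) : Type := {α : Idx n × Idx n // α.1 ≠ α.2}

namespace Root

variable {n : ℕ}

/-- The vector `e_i`, with `e_{-i} = -e_i`. -/
def basisVec (i : Idx n) : Idx n → ℤ := Pi.single i 1 - Pi.single i.opp 1

/-- The root `e_i - e_j` of the index pair `(i, j)`. -/
def vec (α : Root n) : Idx n → ℤ := basisVec α.1.1 - basisVec α.1.2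

theorem basisVec_opp (i : Idx n) : basisVec i.opp = -basisVec i := by
  rw [basisVec, basisVec, Idx.opp_opp]; abel

theorem vec_pos_iff (α : Root n) (x : Idx n) : 0 < vec α x ↔ x = α.1.1 ∨ x = α.1.2.opp := by
  obtain ⟨⟨i, j⟩, h⟩ := α
  have h1 := Idx.opp_ne i
  have h2 := Idx.opp_ne j
  have h3 : i.opp ≠ j.opp := fun e => h (Idx.opp_inj.1 e)
  simp only [vec, basisVec, Pi.sub_apply, Pi.single_apply]
  split_ifs <;> grind

theorem vec_swap {i j : Idx n} (h : i ≠ j) : vec ⟨(j, i), h.symm⟩ = -vec ⟨(i, j), h⟩ := by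
  simp only [vec]; abel

theorem vec_opp {i j : Idx n} (h : i ≠ j) (h' : j.opp ≠ i.opp) :
    vec ⟨(j.opp, i.opp), h'⟩ = vec ⟨(i, j), h⟩ := by
  simp only [vec, basisVec_opp]; abel

theorem eq_or_eq_opp {α β : Root n} (h : ∀ x, 0 < vec α x ↔ 0 < vec β x) :
    (β.1.1 = α.1.1 ∧ β.1.2 = α.1.2) ∨ (β.1.1 = α.1.2.opp ∧ β.1.2 = α.1.1.opp) := by
  simp only [vec_pos_iff] at h
  have h1 := (h α.1.1).1 (Or.inl rfl)
  have h2 := (h α.1.2.opp).1 (Or.inr rfl)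
  have h3 := (h β.1.1).2 (Or.inl rfl)
  have h4 := (h β.1.2.opp).2 (Or.inr rfl)
  simp only [Idx.opp_inj] at h2 h4
  grind [Idx.opp_opp]

theorem vec_eq_of_pos_iff {α β : Root n} (h : ∀ x, 0 < vec α x ↔ 0 < vec β x) :
    vec α = vec β := by
  rcases eq_or_eq_opp h with ⟨h1, h2⟩ | ⟨h1, h2⟩
  · simp only [vec, h1, h2]
  · simp only [vec, h1, h2, basisVec_opp]; abel

/-- The positions of the positive coordinates of a root determine it, and they agree for
proportional roots with a positive factor. -/
theorem reduced : Reduced (vec : Root n → Idx n → ℤ) := by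
  intro α β p q hp h
  have hx : ∀ x, p * vec α x = q * vec β x := fun x => by
    have := congrFun h x
    simpa using this
  rcases lt_trichotomy q 0 with hq | hq | hq
  · right
    obtain ⟨⟨k, l⟩, hkl⟩ := β
    rw [← vec_swap hkl]
    refine vec_eq_of_pos_iff fun x => ?_
    rw [vec_swap hkl, Pi.neg_apply]
    have := hx x
    constructor
    · intro h1; nlinarith
    · intro h1; nlinarith
  · exfalso
    have h1 := (vec_pos_iff α α.1.1).2 (Or.inl rfl)
    have := hx α.1.1
    rw [hq] at this
    nlinarith
  · left
    refine vec_eq_of_pos_iff fun x => ?_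
    have := hx x
    constructor
    · intro h1; nlinarith
    · intro h1; nlinarith

theorem vec_add_eq_zero_iff {i j k l : Idx n} (h : i ≠ j) (h' : k ≠ l) :
    vec ⟨(i, j), h⟩ + vec ⟨(k, l), h'⟩ = 0 ↔ (k = j ∧ l = i) ∨ (k = i.opp ∧ l = j.opp) := by
  constructor
  · intro h0
    have h1 : vec ⟨(j, i), h.symm⟩ = vec ⟨(k, l), h'⟩ := by
      rw [vec_swap h, neg_eq_iff_add_eq_zero]; exact h0
    exact eq_or_eq_opp (α := ⟨(j, i), h.symm⟩) (β := ⟨(k, l), h'⟩) fun x => by rw [h1]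
  · rintro (⟨rfl, rfl⟩ | ⟨rfl, rfl⟩)
    · simp only [vec]; abel
    · simp only [vec, basisVec_opp]; abel

theorem vec_eq_iff {i j k l : Idx n} (h : i ≠ j) (h' : k ≠ l) :
    vec ⟨(i, j), h⟩ = vec ⟨(k, l), h'⟩ ↔ (k = i ∧ l = j) ∨ (k = j.opp ∧ l = i.opp) := by
  rw [← neg_neg (vec ⟨(i, j), h⟩), ← vec_swap h, neg_eq_iff_add_eq_zero, vec_add_eq_zero_iff]

end Root

open Root

variable {A : Type*} [Ring A] [StarRing A] {F : FormRing A} {n : ℕ}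

namespace FormIdeal

/-- The root subgroup of level `(I, Γ)`: the transvections `T_{ij}(a)`, `a ∈ I`, for a short root,
and the `T_{i,-i}(a)`, `a ∈ λ^{-(ε(i) + 1) / 2} Γ`, for a long root. -/
def root (X : FormIdeal F) (α : Root n) : Subgroup (GL2n n A) where
  carrier := {g | (α.1.1 ≠ α.1.2.opp ∧ ∃ a ∈ X.I, g = F.shortT α.1.1 α.1.2 α.2 a) ∨
    (α.1.2 = α.1.1.opp ∧ ∃ p ∈ X.Gam, g = longT α.1.1 ((((F.mu α.1.1)⁻¹ : Aˣ) : A) * p))}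
  mul_mem' := by
    rintro _ _ (⟨h, a, ha, rfl⟩ | ⟨h, p, hp, rfl⟩) (⟨h', b, hb, rfl⟩ | ⟨h', q, hq, rfl⟩)
    · exact Or.inl ⟨h, a + b, add_mem ha hb, (F.shortT_add _ a b).symm⟩
    · exact absurd (by rw [h', Idx.opp_opp]) h
    · exact absurd (by rw [h, Idx.opp_opp]) h'
    · exact Or.inr ⟨h, p + q, add_mem hp hq, by rw [mul_add, longT_add]⟩
  one_mem' := by
    by_cases h : α.1.2 = α.1.1.opp
    · exact Or.inr ⟨h, 0, zero_mem _, by rw [mul_zero, longT_zero]⟩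
    · exact Or.inl ⟨fun h' => h (by rw [h', Idx.opp_opp]), 0, zero_mem _, (F.shortT_zero _).symm⟩
  inv_mem' := by
    rintro _ (⟨h, a, ha, rfl⟩ | ⟨h, p, hp, rfl⟩)
    · exact Or.inl ⟨h, -a, neg_mem ha, (F.shortT_neg _ a).symm⟩
    · exact Or.inr ⟨h, -p, neg_mem hp, by rw [mul_neg, longT_neg]⟩

variable (X Y : FormIdeal F)

theorem shortT_mem {X : FormIdeal F} {i j : Idx n} (h : i ≠ j) (h' : i ≠ j.opp) {a : A}
    (ha : a ∈ X.I) : F.shortT i j h a ∈ X.root ⟨(i, j), h⟩ :=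
  Or.inl ⟨h', a, ha, rfl⟩

theorem longT_mem {X : FormIdeal F} {i j : Idx n} (h : i ≠ j) (h' : j = i.opp) {p : A}
    (hp : p ∈ X.Gam) : longT i ((((F.mu i)⁻¹ : Aˣ) : A) * p) ∈ X.root ⟨(i, j), h⟩ :=
  Or.inr ⟨h', p, hp, rfl⟩

theorem mem_root {X : FormIdeal F} {i j : Idx n} {h : i ≠ j} {g : GL2n n A} :
    g ∈ X.root ⟨(i, j), h⟩ ↔ (i ≠ j.opp ∧ ∃ a ∈ X.I, g = F.shortT i j h a) ∨
      (j = i.opp ∧ ∃ p ∈ X.Gam, g = longT i ((((F.mu i)⁻¹ : Aˣ) : A) * p)) :=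
  Iff.rfl

theorem root_le {X : FormIdeal F} {i j : Idx n} {h : i ≠ j} {H : Subgroup (GL2n n A)}
    (h1 : i ≠ j.opp → ∀ a ∈ X.I, F.shortT i j h a ∈ H)
    (h2 : j = i.opp → ∀ p ∈ X.Gam, longT i ((((F.mu i)⁻¹ : Aˣ) : A) * p) ∈ H) :
    X.root ⟨(i, j), h⟩ ≤ H := by
  rintro g (⟨h', a, ha, rfl⟩ | ⟨h', p, hp, rfl⟩)
  · exact h1 h' a ha
  · exact h2 h' p hp

theorem root_mono {X Y : FormIdeal F} (hI : ∀ a ∈ X.I, a ∈ Y.I) (hG : ∀ p ∈ X.Gam, p ∈ Y.Gam)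
    (α : Root n) : X.root α ≤ Y.root α :=
  root_le (fun h a ha => shortT_mem _ h (hI a ha)) (fun h p hp => longT_mem _ h (hG p hp))

theorem mul_top_root_le (α : Root n) : (X.mul (top F)).root α ≤ X.root α :=
  root_mono (fun _ => mul_top_I X) (fun _ => mul_top_Gam X) α

theorem root_mul_comm (α : Root n) : (X.mul Y).root α = (Y.mul X).root α := by
  have h : ∀ X Y : FormIdeal F, (X.mul Y).root α ≤ (Y.mul X).root α := fun X Y => by
    refine root_mono (fun a ha => ?_) (fun p hp => ?_) α
    · rw [mem_mul_I] at ha ⊢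
      rwa [mulAddSubgroup_comm]
    · change p ∈ Y.mulGam X
      rw [mulGam_comm]; exact hp
  exact le_antisymm (h X Y) (h Y X)

theorem root_congr {α β : Root n} (h : vec α = vec β) : X.root α = X.root β := by
  have key : ∀ α β : Root n, vec α = vec β → X.root α ≤ X.root β := by
    rintro ⟨⟨i, j⟩, hij⟩ ⟨⟨k, l⟩, hkl⟩ h
    rcases (vec_eq_iff hij hkl).1 h with ⟨rfl, rfl⟩ | ⟨rfl, rfl⟩
    · exact le_rfl
    · refine root_le (fun h' a ha => ?_) (fun h' p hp => ?_)
      · rw [F.shortT_opp hij hkl]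
        refine shortT_mem hkl ?_ (neg_mem (X.I.mul_mem_left _ _ (X.star_mem a ha)))
        rw [Idx.opp_opp]
        exact h'.symm
      · subst h'
        simp only [Idx.opp_opp]
        exact longT_mem _ rfl hp
  exact le_antisymm (key α β h) (key β α h.symm)

end FormIdeal

end BakUnitary

/-! ### Commutator formulas for root subgroups -/

namespace BakUnitary

open scoped commutatorElement

open RootGroups Root

variable {A : Type*} [Ring A] [StarRing A] {F : FormRing A} {n : ℕ}

namespace FormIdeal

variable (X Y : FormIdeal F)

theorem mul_mem_mul_I {X Y : FormIdeal F} {a b : A} (ha : a ∈ X.I) (hb : b ∈ Y.I) :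
    a * b ∈ (X.mul Y).I :=
  (mem_mul_I X Y).2 (mul_mem_mulAddSubgroup ha hb)

theorem commutator_root_long_le {i l : Idx n} (h : i ≠ i.opp) (h' : i.opp ≠ l) (hil : i ≠ l) :
    ⁅X.root ⟨(i, i.opp), h⟩, Y.root ⟨(i.opp, l), h'⟩⁆ ≤
      span (X.mul Y).root (cone vec ⟨(i, i.opp), h⟩ ⟨(i.opp, l), h'⟩) := by
  rw [Subgroup.commutator_le]
  intro g hg g' hg'
  rcases mem_root.1 hg with ⟨h1, -⟩ | ⟨-, p, hp, rfl⟩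
  · exact absurd (Idx.opp_opp i).symm h1
  rcases mem_root.1 hg' with ⟨h2, b, hb, rfl⟩ | ⟨h2, -⟩
  · rw [F.commutator_long_short hil h' (X.star_eq_of_mem hp) b, ← mul_neg]
    have hl : l.opp ≠ l := Idx.opp_ne l
    have hshort : (⟨(i, l), hil⟩ : Root n) ∈ cone vec ⟨(i, i.opp), h⟩ ⟨(i.opp, l), h'⟩ := by
      left; simp only [vec]; abel
    have hlong : (⟨(l.opp, l), hl⟩ : Root n) ∈ cone vec ⟨(i, i.opp), h⟩ ⟨(i.opp, l), h'⟩ := by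
      right; right; simp only [vec, basisVec_opp]; module
    have hI : (((F.mu i)⁻¹ : Aˣ) : A) * p * b ∈ (X.mul Y).I :=
      mul_mem_mul_I (X.I.mul_mem_left _ _ (X.gam_le_I hp)) hb
    have hG : -(star b * p * b) ∈ (X.mul Y).Gam := by
      have := conj_mem_mulGam (X := X) (Y := Y) (Y.star_mem b hb) hp
      rw [star_star] at this
      exact neg_mem this
    exact mul_mem (mem_span hshort (shortT_mem hil (fun e => h' (by rw [e, Idx.opp_opp])) hI))
      (mem_span hlong (longT_mem hl (Idx.opp_opp l).symm hG))
  · exact absurd (h2.trans (Idx.opp_opp i)) hil.symm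

theorem commutator_root_linked_le {i j l : Idx n} (h : i ≠ j) (h' : j ≠ l) (hil : i ≠ l) :
    ⁅X.root ⟨(i, j), h⟩, Y.root ⟨(j, l), h'⟩⁆ ≤
      span (X.mul Y).root (cone vec ⟨(i, j), h⟩ ⟨(j, l), h'⟩) := by
  by_cases hi : j = i.opp
  · subst hi
    exact commutator_root_long_le X Y h h' hil
  by_cases hl : l = j.opp
  · subst hl
    have hji : j.opp ≠ i.opp := fun e => h (Idx.opp_inj.1 e).symm
    rw [X.root_congr (vec_opp h hji).symm, Subgroup.commutator_comm, cone_comm]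
    have := commutator_root_long_le Y X h' hji (fun e => hi e)
    have e : cone (vec (n := n)) ⟨(j, j.opp), h'⟩ ⟨(j.opp, i.opp), hji⟩ =
        cone vec ⟨(j, j.opp), h'⟩ ⟨(i, j), h⟩ := by
      simp only [cone, vec_opp h hji]
    rw [← e]
    exact this.trans (span_mono_left (fun α => (Y.root_mul_comm X α).le) _)
  have hi' : i ≠ j.opp := fun e => hi (by rw [e, Idx.opp_opp])
  have hl' : j ≠ l.opp := fun e => hl (by rw [e, Idx.opp_opp])
  have hcone : (⟨(i, l), hil⟩ : Root n) ∈ cone vec ⟨(i, j), h⟩ ⟨(j, l), h'⟩ := by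
    left; simp only [vec]; abel
  rw [Subgroup.commutator_le]
  intro g hg g' hg'
  rcases mem_root.1 hg with ⟨-, a, ha, rfl⟩ | ⟨h1, -⟩
  swap
  · exact absurd h1 hi
  rcases mem_root.1 hg' with ⟨-, b, hb, rfl⟩ | ⟨h2, -⟩
  · have hI : a * b ∈ (X.mul Y).I := mul_mem_mul_I ha hb
    refine mem_span hcone ?_
    by_cases hil' : i = l.opp
    · obtain rfl : l = i.opp := by rw [hil', Idx.opp_opp]
      rw [F.commutator_short_short_long h hi' h']
      have hG := (X.mul Y).tr_mem ((X.mul Y).I.mul_mem_left (F.mu i : A) _ hI)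
      exact longT_mem hil rfl hG
    · rw [F.commutator_short_short h hi' h' hl' hil hil']
      exact shortT_mem hil hil' hI
  · exact absurd h2 hl

theorem commutator_root_unlinked {i j k l : Idx n} (hij : i ≠ j) (hkl : k ≠ l) (h1 : j ≠ k)
    (h2 : l ≠ i) (h3 : j ≠ l.opp) (h4 : i ≠ k.opp) :
    ⁅X.root ⟨(i, j), hij⟩, Y.root ⟨(k, l), hkl⟩⁆ = ⊥ := by
  rw [eq_bot_iff, Subgroup.commutator_le]
  simp only [Subgroup.mem_bot]
  rintro _ (⟨h, a, ha, rfl⟩ | ⟨h, p, hp, rfl⟩) _ (⟨h', b, hb, rfl⟩ | ⟨h', q, hq, rfl⟩)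
  · exact F.commutator_short_unlinked hij hkl h1 h2 h3 h4 a b
  · rw [← commutatorElement_inv, inv_eq_one]
    exact F.commutator_long_short_unlinked hij (fun e => h2 (h'.trans e)) h1 _ a
  · exact F.commutator_long_short_unlinked hkl (fun e => h1 (h.trans e)) h2 _ b
  · exact commutator_long_long (fun e => h1 (h.trans e)) _ _

/-- Two index pairs are linked, up to replacing each pair `(i, j)` by `(-j, -i)`, if they are of
the form `(i, j)` and `(j, l)`; otherwise their root subgroups commute. -/
theorem commutatorFormula : CommutatorFormula vec (X.root (n := n)) Y.root (X.mul Y).root := by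
  have key : ∀ {i j l : Idx n} (h : i ≠ j) (h' : j ≠ l) (α β : Root n),
      vec α = vec ⟨(i, j), h⟩ → vec β = vec ⟨(j, l), h'⟩ → vec α + vec β ≠ 0 →
      ⁅X.root α, Y.root β⁆ ≤ span (X.mul Y).root (cone vec α β) := by
    intro i j l h h' α β hα hβ h0
    have e : cone (vec (n := n)) α β = cone vec ⟨(i, j), h⟩ ⟨(j, l), h'⟩ := by
      simp only [cone, hα, hβ]
    rw [X.root_congr hα, Y.root_congr hβ, e]
    refine commutator_root_linked_le X Y h h' fun hil => h0 ?_
    rw [hα, hβ, vec_add_eq_zero_iff]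
    exact Or.inl ⟨rfl, hil.symm⟩
  rintro ⟨⟨i, j⟩, hij⟩ ⟨⟨k, l⟩, hkl⟩ h0
  have hij' : j.opp ≠ i.opp := fun e => hij (Idx.opp_inj.1 e).symm
  have hkl' : l.opp ≠ k.opp := fun e => hkl (Idx.opp_inj.1 e).symm
  by_cases h1 : j = k
  · subst h1
    exact key hij hkl _ _ rfl rfl h0
  by_cases h3 : j = l.opp
  · subst h3
    exact key hij hkl' _ _ rfl (vec_opp hkl hkl').symm h0
  by_cases h4 : i = k.opp
  · obtain rfl : k = i.opp := by rw [h4, Idx.opp_opp]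
    exact key hij' hkl _ _ (vec_opp hij hij').symm rfl h0
  by_cases h2 : l = i
  · subst h2
    exact key hij' hkl' _ _ (vec_opp hij hij').symm (vec_opp hkl hkl').symm h0
  rw [commutator_root_unlinked X Y hij hkl h1 h2 h3 h4]
  exact bot_le

theorem commutatorFormula_top :
    CommutatorFormula vec ((top F).root (n := n)) X.root X.root := fun α β h =>
  (((X.commutatorFormula (top F)).symm) α β h).trans (span_mono_left (mul_top_root_le X) _)

/-! ### Generation by commutators -/

theorem exists_idx_avoiding (hn : 3 ≤ n) (i j : Idx n) :
    ∃ h : Idx n, h ≠ i ∧ h ≠ i.opp ∧ h ≠ j ∧ h ≠ j.opp := by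
  let f : Idx n → Fin n := Sum.elim id id
  have : ∃ k : Fin n, k ∉ ({f i, f j} : Finset (Fin n)) := by
    by_contra! h
    have h1 : (Finset.univ : Finset (Fin n)).card ≤ ({f i, f j} : Finset (Fin n)).card :=
      Finset.card_le_card fun x _ => h x
    have h2 := Finset.card_le_two (a := f i) (b := f j)
    rw [Finset.card_univ, Fintype.card_fin] at h1
    omega
  obtain ⟨k, hk⟩ := this
  simp only [Finset.mem_insert, Finset.mem_singleton, not_or] at hk
  have hopp : ∀ x : Idx n, f x.opp = f x := by rintro (x | x) <;> rfl
  refine ⟨Sum.inl k, ?_, ?_, ?_, ?_⟩ <;> rintro e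
  · exact hk.1 (by rw [← e]; rfl)
  · exact hk.1 (by rw [← hopp, ← e]; rfl)
  · exact hk.2 (by rw [← e]; rfl)
  · exact hk.2 (by rw [← hopp, ← e]; rfl)

/-- The commutator of transvections of roots other than `±α` belongs to `commutatorsAvoiding`. -/
theorem commutator_mem_avoiding {X Y : FormIdeal F} {α : Root n} {i j k l : Idx n} (hij : i ≠ j)
    (hkl : k ≠ l)
    (h1 : vec ⟨(i, j), hij⟩ ≠ vec α ∧ vec ⟨(i, j), hij⟩ ≠ -vec α)
    (h2 : vec ⟨(k, l), hkl⟩ ≠ vec α ∧ vec ⟨(k, l), hkl⟩ ≠ -vec α) {u w : GL2n n A}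
    (hu : u ∈ X.root ⟨(i, j), hij⟩) (hw : w ∈ Y.root ⟨(k, l), hkl⟩) :
    ⁅u, w⁆ ∈ commutatorsAvoiding vec X.root Y.root α ∧
      ⁅w, u⁆ ∈ commutatorsAvoiding vec X.root Y.root α := by
  have h := Subgroup.subset_closure (k := {z | ∃ β γ : Root n,
    (vec β ≠ vec α ∧ vec β ≠ -vec α) ∧ (vec γ ≠ vec α ∧ vec γ ≠ -vec α) ∧
      ∃ u ∈ X.root β, ∃ w ∈ Y.root γ, z = ⁅u, w⁆}) ⟨_, _, h1, h2, u, hu, w, hw, rfl⟩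
  refine ⟨h, ?_⟩
  rw [← commutatorElement_inv]
  exact inv_mem h

theorem commutatorsAvoiding_comm (α : Root n) :
    commutatorsAvoiding vec X.root Y.root α ≤ commutatorsAvoiding vec Y.root X.root α := by
  rw [commutatorsAvoiding, Subgroup.closure_le]
  rintro _ ⟨⟨⟨i, j⟩, hij⟩, ⟨⟨k, l⟩, hkl⟩, h1, h2, u, hu, w, hw, rfl⟩
  exact (commutator_mem_avoiding hkl hij h2 h1 hw hu).2

/-- For an index `h ≠ ±i, ±l` one has `T_{il}(ab) = [T_{ih}(a), T_{hl}(b)]`. -/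
theorem shortT_mul_mem_avoiding {X Y : FormIdeal F} (hn : 3 ≤ n) {α : Root n} {i l : Idx n}
    (hil : i ≠ l) (hil' : i ≠ l.opp) (hα : ∀ h : Idx n, h ≠ i → h ≠ i.opp → h ≠ l → h ≠ l.opp →
      ∀ (h1 : i ≠ h) (h2 : h ≠ l),
      (vec ⟨(i, h), h1⟩ ≠ vec α ∧ vec ⟨(i, h), h1⟩ ≠ -vec α) ∧
      (vec ⟨(h, l), h2⟩ ≠ vec α ∧ vec ⟨(h, l), h2⟩ ≠ -vec α)) {a b : A}
    (ha : a ∈ X.I) (hb : b ∈ Y.I) :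
    F.shortT i l hil (a * b) ∈ commutatorsAvoiding vec X.root Y.root α := by
  obtain ⟨h, h1, h2, h3, h4⟩ := exists_idx_avoiding hn i l
  have h2' : i ≠ h.opp := fun e => h2 (by rw [e, Idx.opp_opp])
  have hh := hα h h1 h2 h3 h4 h1.symm h3
  rw [← F.commutator_short_short h1.symm h2' h3 h4 hil hil']
  exact (commutator_mem_avoiding h1.symm h3 hh.1 hh.2 (shortT_mem _ h2' ha) (shortT_mem _ h4 hb)).1

theorem ne_vec_iff {i j k l : Idx n} (h : i ≠ j) (h' : k ≠ l) :
    (vec ⟨(i, j), h⟩ ≠ vec ⟨(k, l), h'⟩ ∧ vec ⟨(i, j), h⟩ ≠ -vec ⟨(k, l), h'⟩) ↔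
      ¬((k = i ∧ l = j) ∨ (k = j.opp ∧ l = i.opp)) ∧
      ¬((l = i ∧ k = j) ∨ (l = j.opp ∧ k = i.opp)) := by
  rw [← vec_swap h', Ne, Ne, vec_eq_iff, vec_eq_iff]

/-- The long root factor of `[T_{j,-j}(p), T_{-j,-i}(b̄)]` is, up to sign, `T_{i,-i}(b p b̄)`; its short
root factor is in turn a commutator. -/
theorem longT_conj_mem_avoiding {X Y : FormIdeal F} (hn : 3 ≤ n) {i : Idx n} (hi : i ≠ i.opp)
    {b p : A} (hb : b ∈ Y.I) (hp : p ∈ X.Gam) :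
    longT i ((((F.mu i)⁻¹ : Aˣ) : A) * (b * p * star b)) ∈
      commutatorsAvoiding vec X.root Y.root ⟨(i, i.opp), hi⟩ := by
  obtain ⟨j, h1, h2, -, -⟩ := exists_idx_avoiding hn i i
  have hj : j ≠ j.opp := (Idx.opp_ne j).symm
  have hji : j.opp ≠ i.opp := fun e => h1 (Idx.opp_inj.1 e)
  have key := F.commutator_long_short h2 hji (X.star_eq_of_mem hp) (star b)
  rw [star_star, Idx.opp_opp, ← mul_neg] at key
  rw [mul_neg, longT_neg, ← inv_mul_eq_iff_eq_mul, eq_inv_iff_mul_eq_one,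
    mul_eq_one_iff_inv_eq, eq_comm] at key
  rw [key, inv_mem_iff]
  refine mul_mem (inv_mem ?_) ?_
  · refine shortT_mul_mem_avoiding hn h2 (by rwa [Idx.opp_opp]) ?_
      (X.I.mul_mem_left _ _ (X.gam_le_I hp)) (Y.star_mem b hb)
    intro h h3 h4 h5 h6 h7 h8
    rw [ne_vec_iff, ne_vec_iff]
    have := Idx.opp_ne i
    have := Idx.opp_ne h
    grind [Idx.opp_opp]
  · refine (commutator_mem_avoiding hj hji ?_ ?_ (longT_mem hj rfl hp)
      (shortT_mem hji (fun e => h2 (by rw [← Idx.opp_opp j, e, Idx.opp_opp])) (Y.star_mem b hb))).1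
    · rw [ne_vec_iff]; grind [Idx.opp_opp]
    · rw [ne_vec_iff]; grind [Idx.opp_opp]

theorem longT_tr_mul_mem_avoiding {X Y : FormIdeal F} (hn : 3 ≤ n) {i : Idx n} (hi : i ≠ i.opp)
    {a b : A} (ha : a ∈ X.I) (hb : b ∈ Y.I) :
    longT i ((((F.mu i)⁻¹ : Aˣ) : A) * F.tr (a * b)) ∈
      commutatorsAvoiding vec X.root Y.root ⟨(i, i.opp), hi⟩ := by
  obtain ⟨j, h1, h2, -, -⟩ := exists_idx_avoiding hn i i
  have h2' : i ≠ j.opp := fun e => h2 (by rw [e, Idx.opp_opp])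
  have key := F.commutator_short_short_long h1.symm h2' h2 ((((F.mu i)⁻¹ : Aˣ) : A) * a) b
  rw [mul_assoc, Units.mul_inv_cancel_left] at key
  rw [← key]
  refine (commutator_mem_avoiding h1.symm h2 ?_ ?_
    (shortT_mem _ h2' (X.I.mul_mem_left _ _ ha)) (shortT_mem _ ?_ hb)).1
  · rw [ne_vec_iff]; grind [Idx.opp_opp]
  · rw [ne_vec_iff]; grind [Idx.opp_opp]
  · rw [Idx.opp_opp]; exact h1

/-- The elements of the root subgroup of `α` of level the product of `(I, Γ)` and `(J, Δ)` are
products of commutators of elements of root subgroups for roots other than `±α`. -/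
theorem root_mul_le (hn : 3 ≤ n) (α : Root n) :
    (X.mul Y).root α ≤ commutatorsAvoiding vec X.root Y.root α := by
  obtain ⟨⟨i, j⟩, hij⟩ := α
  refine root_le (fun h a ha => ?_) (fun h p hp => ?_)
  · have hs : ∀ X Y : FormIdeal F, ∀ a ∈ X.I, ∀ b ∈ Y.I, F.shortT i j hij (a * b) ∈
        commutatorsAvoiding vec X.root Y.root ⟨(i, j), hij⟩ := fun X Y a ha b hb => by
      refine shortT_mul_mem_avoiding hn hij h (fun k h3 h4 h5 h6 h7 h8 => ?_) ha hb
      rw [ne_vec_iff, ne_vec_iff]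
      grind [Idx.opp_opp]
    have hle : X.mulAddSubgroup Y ≤ (Subgroup.toAddSubgroup
        (commutatorsAvoiding vec X.root Y.root ⟨(i, j), hij⟩)).comap (F.shortHom hij) :=
      mulAddSubgroup_le fun a ha b hb =>
        ⟨hs X Y a ha b hb, commutatorsAvoiding_comm Y X _ (hs Y X b hb a ha)⟩
    exact hle ((mem_mul_I X Y).1 ha)
  · subst h
    let f : A →+ Additive (GL2n n A) :=
      (longHom i).comp (AddMonoidHom.mulLeft (((F.mu i)⁻¹ : Aˣ) : A))
    have hle : X.mulGam Y ≤ (Subgroup.toAddSubgroup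
        (commutatorsAvoiding vec X.root Y.root ⟨(i, i.opp), hij⟩)).comap f := by
      refine mulGam_le (fun k hk => ?_) (fun b hb p hp => longT_conj_mem_avoiding hn hij hb hp)
        (fun a ha p hp => commutatorsAvoiding_comm Y X _ (longT_conj_mem_avoiding hn hij ha hp))
      have htr : X.mulAddSubgroup Y ≤ ((Subgroup.toAddSubgroup
          (commutatorsAvoiding vec X.root Y.root ⟨(i, i.opp), hij⟩)).comap f).comap F.tr :=
        mulAddSubgroup_le fun a ha b hb => ⟨longT_tr_mul_mem_avoiding hn hij ha hb,
          commutatorsAvoiding_comm Y X _ (longT_tr_mul_mem_avoiding hn hij hb ha)⟩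
      exact htr hk
    exact hle hp

end FormIdeal

end BakUnitary

/-! ### Generating sets of roots without opposite roots -/

namespace BakUnitary

open scoped commutatorElement

open RootGroups Root

variable {A : Type*} [Ring A] [StarRing A] {F : FormRing A} {n : ℕ}

namespace FormIdeal

/-- The subgroup `H` contains the root subgroup of `(i, j)`; used for `i ≠ ±j` only. -/
def ContainsShort (F : FormRing A) (H : Subgroup (GL2n n A)) (i j : Idx n) : Prop :=
  ∀ h : i ≠ j, (top F).root ⟨(i, j), h⟩ ≤ H

namespace ContainsShort

variable {H : Subgroup (GL2n n A)} {i j l : Idx n}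

theorem opp (h : ContainsShort F H i j) : ContainsShort F H j.opp i.opp := by
  intro h'
  have hij : i ≠ j := fun e => h' (by rw [e])
  rw [(top F).root_congr (vec_opp hij h')]
  exact h hij

theorem trans (h : ContainsShort F H i j) (h' : ContainsShort F H j l) (hij : i ≠ j)
    (hij' : i ≠ j.opp) (hjl : j ≠ l) (hjl' : j ≠ l.opp) (hil' : i ≠ l.opp) :
    ContainsShort F H i l := by
  intro hil
  refine root_le (fun _ a ha => ?_) (fun e => absurd (by rw [e, Idx.opp_opp]) hil')
  have h1 : (1 : A) ∈ (top F).I := trivial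
  rw [← mul_one a, ← F.commutator_short_short hij hij' hjl hjl' hil hil']
  exact H.commutator_le_self (Subgroup.commutator_mem_commutator (h hij (shortT_mem _ hij' ha))
    (h' hjl (shortT_mem _ hjl' h1)))

/-- From `2e_i` to `2e_l`, using the commutator of `T_{i,-i}(p)` and `T_{-i,-l}(1)`. -/
theorem long (hi : i ≠ i.opp) (hl : l ≠ l.opp) (hil : i ≠ l) (hil' : i ≠ l.opp)
    (h : (top F).root ⟨(i, i.opp), hi⟩ ≤ H) (h' : ContainsShort F H i.opp l.opp)
    (h'' : ContainsShort F H i l.opp) : (top F).root ⟨(l, l.opp), hl⟩ ≤ H := by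
  refine root_le (fun e => absurd (Idx.opp_opp l).symm e) (fun _ p hp => ?_)
  have h1 : (1 : A) ∈ (top F).I := trivial
  have h2 : i.opp ≠ l.opp := fun e => hil (Idx.opp_inj.1 e)
  have key := F.commutator_long_short hil' h2 ((top F).star_eq_of_mem hp) 1
  rw [Idx.opp_opp, star_one, one_mul, mul_one, mul_one] at key
  have e : i ≠ l.opp.opp := by rwa [Idx.opp_opp]
  have m1 := h'' hil' (shortT_mem hil' e ((top F).I.mul_mem_left
    (((F.mu i)⁻¹ : Aˣ) : A) _ ((top F).gam_le_I hp)))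
  have m2 := h (longT_mem hi rfl hp)
  have m3 := h' h2 (shortT_mem h2 (fun e => hil' (by rw [← Idx.opp_opp i, e, Idx.opp_opp])) h1)
  have m4 := H.commutator_le_self (Subgroup.commutator_mem_commutator m2 m3)
  rw [key] at m4
  rw [longT_neg] at m4
  exact inv_mem_iff.1 ((Subgroup.mul_mem_cancel_left _ m1).1 m4)

end ContainsShort

/-- The index pairs of the short roots of `genRoots a b c`: a cycle through `a`, `b`, `c`, the roots
`e_a + e_b` and `-e_c - e_b`, and for the remaining indices `k` the roots `e_a - e_k`
and `e_k - e_c`. -/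
def ShortGen (a b c i j : Idx n) : Prop :=
  (i = a ∧ j = b) ∨ (i = b ∧ j = c) ∨ (i = c ∧ j = a) ∨ (i = a ∧ j = b.opp) ∨
    (i = c.opp ∧ j = b) ∨
    (i = a ∧ j ≠ a ∧ j ≠ a.opp ∧ j ≠ b ∧ j ≠ b.opp ∧ j ≠ c ∧ j ≠ c.opp) ∨
    (j = c ∧ i ≠ a ∧ i ≠ a.opp ∧ i ≠ b ∧ i ≠ b.opp ∧ i ≠ c ∧ i ≠ c.opp)

/-- The three indices have distinct absolute values. -/
def Distinct (a b c : Idx n) : Prop :=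
  a ≠ b ∧ a ≠ b.opp ∧ b ≠ c ∧ b ≠ c.opp ∧ a ≠ c ∧ a ≠ c.opp

/-- A subgroup with the short root subgroups of `ShortGen a b c` contains all short root
subgroups, since every index is linked to `a` through them; then one long root subgroup yields the
others. -/
theorem root_le_of_shortGen {a b c l : Idx n} (hd : Distinct a b c) {H : Subgroup (GL2n n A)}
    (h : ∀ i j, ShortGen a b c i j → ContainsShort F H i j) (hl : l ≠ l.opp)
    (hlong : (top F).root ⟨(l, l.opp), hl⟩ ≤ H) (α : Root n) : (top F).root α ≤ H := by
  obtain ⟨ab, ab', bc, bc', ac, ac'⟩ := hd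
  have opp_ne := Idx.opp_ne (n := n)
  have opp_opp := Idx.opp_opp (n := n)
  have hab := h a b (by simp [ShortGen])
  have hbc := h b c (by simp [ShortGen])
  have hca := h c a (by simp [ShortGen])
  have hab' := h a b.opp (by simp [ShortGen])
  have hcb' := h c.opp b (by simp [ShortGen])
  have sba : ContainsShort F H b a := hbc.trans hca bc bc' (by grind) (by grind) (by grind)
  have sac : ContainsShort F H a c := hab.trans hbc ab ab' bc bc' ac'
  have scb : ContainsShort F H c b := hca.trans hab (by grind) (by grind) ab ab' (by grind)
  have sac' : ContainsShort F H a c.opp :=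
    hab'.trans scb.opp (by grind) (by grind) (by grind) (by grind) (by grind)
  have sb'a : ContainsShort F H b.opp a := by
    have := hcb'.opp
    rw [opp_opp] at this
    exact this.trans hca (by grind) (by grind) (by grind) (by grind) (by grind)
  have sc'a : ContainsShort F H c.opp a :=
    hcb'.trans sba (by grind) (by grind) (by grind) (by grind) (by grind)
  -- every index is linked to `a` in both directions
  have hub : ∀ k, k ≠ a → k ≠ a.opp → ContainsShort F H a k ∧ ContainsShort F H k a := by
    intro k h1 h2
    by_cases kb : k = b
    · subst kb; exact ⟨hab, sba⟩
    by_cases kb' : k = b.opp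
    · subst kb'; exact ⟨hab', sb'a⟩
    by_cases kc : k = c
    · subst kc; exact ⟨sac, hca⟩
    by_cases kc' : k = c.opp
    · subst kc'; exact ⟨sac', sc'a⟩
    refine ⟨h a k (by simp [ShortGen, *]), ?_⟩
    exact (h k c (by simp [ShortGen, *])).trans hca kc kc' (by grind) (by grind) h2
  have hshort : ∀ i j, i ≠ j → i ≠ j.opp → ContainsShort F H i j := by
    intro i j hij hij'
    by_cases hia : i = a
    · subst hia; exact (hub j hij.symm (by grind)).1
    by_cases hja : j = a
    · subst hja; exact (hub i hij hij').2
    by_cases hia' : i = a.opp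
    · subst hia'
      have := (hub j.opp (by grind) (by grind)).2.opp
      rwa [opp_opp] at this
    by_cases hja' : j = a.opp
    · subst hja'
      have := (hub i.opp (by grind) (by grind)).1.opp
      rwa [opp_opp] at this
    exact (hub i hia hia').2.trans (hub j hja hja').1 hia hia' (by grind) (by grind) hij'
  have step : ∀ (i j : Idx n) (hi : i ≠ i.opp) (hj : j ≠ j.opp), i ≠ j → i ≠ j.opp →
      (top F).root ⟨(i, i.opp), hi⟩ ≤ H → (top F).root ⟨(j, j.opp), hj⟩ ≤ H :=
    fun i j hi hj h1 h2 h3 => ContainsShort.long hi hj h1 h2 h3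
      (hshort _ _ (by grind) (by grind)) (hshort _ _ (by grind) (by grind))
  obtain ⟨⟨i, j⟩, hij⟩ := α
  by_cases hs : i = j.opp
  · obtain rfl : j = i.opp := by rw [hs, opp_opp]
    -- pass through a third index when `i = ±l`
    obtain ⟨k, hk⟩ : ∃ k, (k ≠ l ∧ k ≠ l.opp) ∧ (k ≠ i ∧ k ≠ i.opp) := by
      by_cases ha : (a ≠ l ∧ a ≠ l.opp) ∧ (a ≠ i ∧ a ≠ i.opp)
      · exact ⟨a, ha⟩
      by_cases hb : (b ≠ l ∧ b ≠ l.opp) ∧ (b ≠ i ∧ b ≠ i.opp)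
      · exact ⟨b, hb⟩
      · exact ⟨c, by grind⟩
    have hk' : k ≠ k.opp := (opp_ne k).symm
    exact step k i hk' hij hk.2.1 hk.2.2 (step l k hl hk' hk.1.1.symm (by grind) hlong)
  · exact hshort i j hij hs hij

/-- A set of roots that contains no two opposite roots, but whose root subgroups generate
the elementary group, as do those of the opposite roots. -/
def genRoots (a b c : Idx n) : Set (Root n) :=
  {α | ShortGen a b c α.1.1 α.1.2 ∨ (α.1.1 = b ∧ α.1.2 = b.opp)}

/-- The roots opposite to those of `genRoots a b c`; up to the long root, these are the roots of
`genRoots c b a`. -/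
def oppGenRoots (a b c : Idx n) : Set (Root n) :=
  {α | ShortGen a b c α.1.2 α.1.1 ∨ (α.1.2 = b ∧ α.1.1 = b.opp)}

theorem vec_add_ne_zero_of_genRoots {a b c : Idx n} (hd : Distinct a b c) :
    ∀ α ∈ genRoots a b c, ∀ β ∈ genRoots a b c, vec α + vec β ≠ 0 := by
  obtain ⟨ab, ab', bc, bc', ac, ac'⟩ := hd
  have opp_ne := Idx.opp_ne (n := n)
  have opp_opp := Idx.opp_opp (n := n)
  rintro ⟨⟨i, j⟩, hij⟩ hα ⟨⟨k, l⟩, hkl⟩ hβ h0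
  rw [vec_add_eq_zero_iff] at h0
  simp only [genRoots, ShortGen, Set.mem_ofPred_eq] at hα hβ
  rcases h0 with ⟨rfl, rfl⟩ | ⟨rfl, rfl⟩
  · rcases hα with (h | h | h | h | h | h | h) | h <;> grind
  · rcases hα with (h | h | h | h | h | h | h) | h <;> grind

theorem span_genRoots {a b c : Idx n} (hd : Distinct a b c) (α : Root n) :
    (top F).root α ≤ span (top F).root (genRoots a b c) := by
  have hb : b ≠ b.opp := (Idx.opp_ne b).symm
  refine root_le_of_shortGen hd (fun i j h hij g hg => ?_) hb (fun g hg => ?_) α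
  · have hm : (⟨(i, j), hij⟩ : Root n) ∈ genRoots a b c := Or.inl h
    exact mem_span hm hg
  · have hm : (⟨(b, b.opp), hb⟩ : Root n) ∈ genRoots a b c := Or.inr ⟨rfl, rfl⟩
    exact mem_span hm hg

theorem span_oppGenRoots {a b c : Idx n} (hd : Distinct a b c) (α : Root n) :
    (top F).root α ≤ span (top F).root (oppGenRoots a b c) := by
  obtain ⟨ab, ab', bc, bc', ac, ac'⟩ := hd
  have opp_ne := Idx.opp_ne (n := n)
  have opp_opp := Idx.opp_opp (n := n)
  have hb : b.opp ≠ b.opp.opp := (Idx.opp_ne b.opp).symm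
  have hd' : Distinct c b a := ⟨bc.symm, by grind, ab.symm, by grind, ac.symm, by grind⟩
  refine root_le_of_shortGen hd' (fun i j h hij g hg => ?_) hb (fun g hg => ?_) α
  · by_cases hji : ShortGen a b c j i
    · have hm : (⟨(i, j), hij⟩ : Root n) ∈ oppGenRoots a b c := Or.inl hji
      exact mem_span hm hg
    · have hij' : j.opp ≠ i.opp := fun e => hij (Idx.opp_inj.1 e).symm
      rw [(top F).root_congr (vec_opp hij hij').symm] at hg
      suffices hm : (⟨(j.opp, i.opp), hij'⟩ : Root n) ∈ oppGenRoots a b c from mem_span hm hg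
      left
      simp only [ShortGen] at h hji ⊢
      rcases h with (h | h | h | h | h | h | h) <;> grind
  · have hm : (⟨(b.opp, b.opp.opp), hb⟩ : Root n) ∈ oppGenRoots a b c := Or.inr ⟨opp_opp b, rfl⟩
    exact mem_span hm hg

theorem exists_distinct (hn : 3 ≤ n) : ∃ a b c : Idx n, Distinct a b c := by
  refine ⟨Sum.inl ⟨0, by omega⟩, Sum.inl ⟨1, by omega⟩, Sum.inl ⟨2, by omega⟩, ?_⟩
  simp [Distinct, Idx.opp]

/-- Since `genRoots a b c` contains no two opposite roots, at most one of it and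
`oppGenRoots a b c` contains `-β`. -/
theorem exists_generating_roots (hn : 3 ≤ n) (F : FormRing A) (β : Root n) :
    ∃ T : Set (Root n), (∀ α ∈ T, ∀ γ ∈ T, vec α + vec γ ≠ 0) ∧
      (∀ α ∈ T, vec α + vec β ≠ 0) ∧ ∀ α, (top F).root α ≤ span (top F).root T := by
  obtain ⟨a, b, c, hd⟩ := exists_distinct hn
  have hanti := vec_add_ne_zero_of_genRoots hd
  by_cases h : ∀ α ∈ genRoots a b c, vec α + vec β ≠ 0
  · exact ⟨genRoots a b c, hanti, h, span_genRoots hd⟩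
  push Not at h
  obtain ⟨γ, hγ, hγβ⟩ := h
  have hopp : ∀ α ∈ oppGenRoots a b c, ∃ α' ∈ genRoots a b c, vec α = -vec α' :=
    fun α hα => ⟨⟨(α.1.2, α.1.1), α.2.symm⟩, hα.imp id id, vec_swap α.2.symm⟩
  refine ⟨oppGenRoots a b c, fun α hα δ hδ h0 => ?_, fun α hα h0 => ?_, span_oppGenRoots hd⟩
  · obtain ⟨α', hα', e⟩ := hopp α hα
    obtain ⟨δ', hδ', e'⟩ := hopp δ hδ
    refine hanti α' hα' δ' hδ' ?_
    rw [e, e', ← neg_add, neg_eq_zero] at h0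
    exact h0
  · obtain ⟨α', hα', e⟩ := hopp α hα
    refine hanti γ hγ α' hα' ?_
    rw [← hγβ, eq_neg_of_add_eq_zero_right h0, e, neg_neg]

end FormIdeal

end BakUnitary

/-! ### Passage to the elementary unitary group -/

namespace RootGroups

open scoped commutatorElement

section Restriction

variable {G Φ V : Type*} [Group G] [AddCommGroup V] {E : Subgroup G} {P Q S : Φ → Subgroup G}

theorem map_subgroupOf_of_le {H : Subgroup G} (h : H ≤ E) :
    (H.subgroupOf E).map E.subtype = H := by
  rw [Subgroup.subgroupOf_map_subtype, inf_eq_left.2 h]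

theorem span_subgroupOf (hP : ∀ α, P α ≤ E) (D : Set Φ) :
    span (fun α => (P α).subgroupOf E) D = (span P D).subgroupOf E := by
  apply Subgroup.map_injective E.subtype_injective
  rw [map_subgroupOf_of_le (span_le.2 fun α _ => hP α), span, span, MonoidHom.map_closure]
  congr 1
  ext x
  constructor
  · rintro ⟨y, ⟨α, hα, hy⟩, rfl⟩
    exact ⟨α, hα, hy⟩
  · rintro ⟨α, hα, hx⟩
    exact ⟨⟨x, hP α hx⟩, ⟨α, hα, hx⟩, rfl⟩

theorem commutatorsAvoiding_subgroupOf {rt : Φ → V} (hP : ∀ α, P α ≤ E) (hQ : ∀ α, Q α ≤ E)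
    (α : Φ) :
    (commutatorsAvoiding rt P Q α).subgroupOf E ≤
      commutatorsAvoiding rt (fun α => (P α).subgroupOf E) (fun α => (Q α).subgroupOf E) α := by
  have h : commutatorsAvoiding rt P Q α ≤ (commutatorsAvoiding rt (fun α => (P α).subgroupOf E)
      (fun α => (Q α).subgroupOf E) α).map E.subtype := by
    rw [commutatorsAvoiding, Subgroup.closure_le]
    rintro _ ⟨β, γ, hβ, hγ, u, hu, w, hw, rfl⟩
    exact ⟨⁅⟨u, hP β hu⟩, ⟨w, hQ γ hw⟩⁆,
      Subgroup.subset_closure ⟨β, γ, hβ, hγ, _, hu, _, hw, rfl⟩, rfl⟩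
  intro x hx
  obtain ⟨y, hy, hxy⟩ := h hx
  rwa [← E.subtype_injective hxy]

theorem CommutatorFormula.subgroupOf {rt : Φ → V} (h : CommutatorFormula rt P Q S)
    (hS : ∀ α, S α ≤ E) : CommutatorFormula rt (fun α => (P α).subgroupOf E)
      (fun α => (Q α).subgroupOf E) (fun α => (S α).subgroupOf E) := by
  intro α β hαβ
  rw [span_subgroupOf hS, Subgroup.commutator_le]
  intro x hx y hy
  exact h α β hαβ (Subgroup.commutator_mem_commutator hx hy)

end Restriction

end RootGroups

namespace BakUnitary

open scoped commutatorElement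

open RootGroups Root

variable {A : Type*} [Ring A] [StarRing A] {F : FormRing A} {n : ℕ}

namespace FormIdeal

theorem span_root (X : FormIdeal F) : span (X.root (n := n)) Set.univ = X.FU n := by
  apply le_antisymm
  · refine span_le.2 ?_
    rintro ⟨⟨i, j⟩, hij⟩ -
    refine root_le (fun h a ha => Subgroup.subset_closure (Or.inl ⟨i, j, hij, h, a, ha, rfl⟩))
      (fun h p hp => Subgroup.subset_closure (Or.inr ⟨i, p, hp, ?_⟩))
    rw [F.lamUnit_zpow_long]
  · rw [FU, FormRing.elementarySubgroup, Subgroup.closure_le]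
    rintro _ (⟨i, j, h, h', a, ha, rfl⟩ | ⟨i, p, hp, rfl⟩)
    · exact mem_span (Set.mem_univ _) (shortT_mem h h' ha)
    · rw [F.lamUnit_zpow_long]
      exact mem_span (Set.mem_univ _) (longT_mem (Idx.opp_ne i).symm rfl hp)

theorem FU_top : (top F).FU n = F.EU n := rfl

theorem root_le_EU (X : FormIdeal F) (α : Root n) : X.root α ≤ F.EU n :=
  fun _ hx => X.FU_le_EU n (X.span_root ▸ mem_span (Set.mem_univ α) hx)

theorem top_root_le_mul (α : Root n) : (top F).root α ≤ ((top F).mul (top F)).root α := by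
  have h1 : (1 : A) ∈ (top F).I := trivial
  refine root_mono (fun a ha => ?_) (fun p hp => ?_) α
  · rw [← mul_one a]
    exact mul_mem_mul_I ha h1
  · have := conj_mem_mulGam (X := top F) (Y := top F) h1 hp
    rwa [star_one, one_mul, mul_one] at this

/-- The restriction of the root subgroups to the elementary unitary group. -/
def rootEU (X : FormIdeal F) (α : Root n) : Subgroup (F.EU n) := (X.root α).subgroupOf (F.EU n)

theorem span_rootEU (X : FormIdeal F) :
    span (X.rootEU (n := n)) Set.univ = (X.FU n).subgroupOf (F.EU n) := by
  rw [← span_root]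
  exact span_subgroupOf X.root_le_EU _

theorem mixedSystem (hn : 3 ≤ n) (X Y : FormIdeal F) :
    MixedSystem (vec (n := n)) (top F).rootEU X.rootEU Y.rootEU (X.mul Y).rootEU where
  reduced := Root.reduced
  congr α β h := by rw [rootEU, rootEU, root_congr _ h]
  EE := (commutatorFormula_top (top F)).subgroupOf (top F).root_le_EU
  EP := (commutatorFormula_top X).subgroupOf X.root_le_EU
  EQ := (commutatorFormula_top Y).subgroupOf Y.root_le_EU
  EK := (commutatorFormula_top (X.mul Y)).subgroupOf (X.mul Y).root_le_EU
  PQ := (commutatorFormula X Y).subgroupOf (X.mul Y).root_le_EU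
  le_E α := by
    refine le_trans ?_ (commutatorsAvoiding_subgroupOf (top F).root_le_EU (top F).root_le_EU α)
    exact Subgroup.comap_mono ((top_root_le_mul α).trans ((top F).root_mul_le (top F) hn α))
  le_K α := (Subgroup.comap_mono (X.root_mul_le Y hn α)).trans
    (commutatorsAvoiding_subgroupOf X.root_le_EU Y.root_le_EU α)
  span_E := by
    rw [span_rootEU, FU_top, Subgroup.subgroupOf_self]
  exists_gen β := by
    obtain ⟨T, h1, h2, h3⟩ := exists_generating_roots hn F β
    have hle : F.EU n ≤ span (top F).root T := by
      rw [← FU_top, ← span_root]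
      exact span_le.2 fun α _ => h3 α
    refine ⟨T, h1, h2, (span_subgroupOf (top F).root_le_EU T).trans ?_⟩
    exact Subgroup.subgroupOf_eq_top.2 hle

end FormIdeal

end BakUnitary

open BakUnitary RootGroups in
theorem theorem2 {A : Type*} [Ring A] [StarRing A] (F : BakUnitary.FormRing A)
    (X Y : BakUnitary.FormIdeal F) (n : ℕ) (hn : 3 ≤ n) :
    (⁅X.FU n, Y.FU n⁆ ≤ F.EU n ∧ (⁅X.FU n, Y.FU n⁆.subgroupOf (F.EU n)).Normal) ∧
      ⁅X.FU n, Y.FU n⁆ = ⁅X.relEU n, Y.relEU n⁆ := by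
  have h := FormIdeal.mixedSystem hn X Y
  have : Nonempty (Root n) := ⟨⟨(Sum.inl ⟨0, by omega⟩, Sum.inr ⟨0, by omega⟩), Sum.inl_ne_inr⟩⟩
  have hnormal := h.commutator_normal
  have heq := h.commutator_normalClosure
  rw [X.span_rootEU, Y.span_rootEU] at hnormal heq
  have e : ⁅X.FU n, Y.FU n⁆ =
      ⁅(X.FU n).subgroupOf (F.EU n), (Y.FU n).subgroupOf (F.EU n)⁆.map (F.EU n).subtype := by
    rw [Subgroup.map_commutator, map_subgroupOf_of_le (X.FU_le_EU n),
      map_subgroupOf_of_le (Y.FU_le_EU n)]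
  refine ⟨⟨?_, ?_⟩, ?_⟩
  · rw [e]; exact Subgroup.map_subtype_le _
  · rw [e, Subgroup.subgroupOf, Subgroup.comap_map_eq_self_of_injective (F.EU n).subtype_injective]
    exact hnormal
  · rw [e, ← heq, Subgroup.map_commutator]
    rfl
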